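/- Let $\mathcal X\subset\mathbb R^n$ be compact (for instance $\mathcal X=[0,1]^n$), let $\mathcal Y\subset\mathbb R^m$ be compact and convex, and let the loss $u:\mathcal Y\times\mathcal X\to\mathbb R$ be Lipschitz continuous and convex in its first argument. Let $(X_t)_{t\in\mathbb Z}$ be an $\mathcal X$-valued process that is stationary and ergodic (the shift preserves, and is ergodic for, the law of the whole trajectory) and satisfies the following two conditions. (i) Exponential $\beta$-mixing: there are constants $c,r>0$ such that for all $k\ge 1$ $$\beta_k:=\sup_{l\ge1}\mathbb E\Big[\sup_{B\in\sigma(X_{l+k},X_{l+k+1},\dots)}\big|\mathbb P(B\mid\sigma(X_1,\dots,X_l))-\mathbb P(B)\big|\Big]\le c\,e^{-k^{r}},$$ where $\mathbb P(\,\cdot\mid\sigma(X_1,\dots,X_l))$ is the regular conditional distribution. (ii) Memory bounded by $d\in\mathbb N$: almost surely, the conditional distribution of $X_0$ given $(X_{-1},X_{-2},\dots)$ equals the conditional distribution of $X_0$ given $(X_{-d},\dots,X_{-1})$. Let $\mathbb P_\infty$ be the regular conditional distribution of $X_0$ given the infinite past $(X_{-1},X_{-2},\dots)$, and let $$L^*:=\mathbb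 E\Big[\min_{y\in\mathcal Y}\mathbb E_{\mathbb P_\infty}\big[u(y,X_0)\big]\Big].$$ Let $L_1,L_2,\dots\ge 0$ satisfy $L_T\to\infty$ and $L_T=O\big((\log T)^{p}\big)$ for some real $p$ (for instance, $L_T$ of order $(\log T)^{1/(m+2)}$). For every $T\ge1$ let $f_T:\mathcal X^d\to\mathcal Y$ be a (data-dependent) function which, almost surely, has Lipschitz constant at most $L_T$ with respect to the Euclidean norms and exactly minimizes the empirical loss $$\frac1T\sum_{t=1}^{T}u\big(g(X_{t-d},\dots,X_{t-1}),X_t\big)$$ over all functions $g:\mathcal X^d\to\mathcal Y$ with Lipschitz constant at most $L_T$. Then, almost surely, $$\lim_{T\to\infty}\frac1T\sum_{t=1}^{T}u\big(f_T(X_{t-d},\dots,X_{t-1}),X_t\big)=L^*.$$ -/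

import Mathlib

open MeasureTheory ProbabilityTheory Filter Topology Asymptotics
open scoped NNReal ENNReal

/-- The process `X` is (jointly) stationary and ergodic: the left shift preserves the law of
the whole two-sided trajectory and is ergodic for it. -/
def IsStationaryErgodicProcess {Ω S : Type*} [MeasurableSpace Ω] [MeasurableSpace S]
    (μ : Measure Ω) (X : ℤ → Ω → S) : Prop :=
  Ergodic (fun (x : ℤ → S) (t : ℤ) => x (t + 1)) (μ.map fun ω t => X t ω)

/-- The block of observations `(X₁, …, X_l)`. -/
def initialBlock {Ω S : Type*} (X : ℤ → Ω → S) (l : ℕ) (ω : Ω) : Fin l → S :=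
  fun i => X ((i : ℤ) + 1) ω

/-- The tail of observations `(X_s, X_{s+1}, …)`. -/
def tailFrom {Ω S : Type*} (X : ℤ → Ω → S) (s : ℕ) (ω : Ω) : ℕ → S :=
  fun j => X ((s : ℤ) + (j : ℤ)) ω

/-- The coefficient of absolute regularity
`β_k = sup_{l ≥ 1} 𝔼 [ sup_{B ∈ σ(X_{l+k}, X_{l+k+1}, …)} |ℙ(B ∣ σ(X₁, …, X_l)) - ℙ(B)| ]`,
where `ℙ(· ∣ σ(X₁, …, X_l))` is the regular conditional distribution. The events `B` are written
as preimages of measurable sets of sequences. -/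
noncomputable def betaCoeff {Ω S : Type*} [MeasurableSpace Ω] [MeasurableSpace S]
    [StandardBorelSpace S] [Nonempty S] (μ : Measure Ω) [IsFiniteMeasure μ]
    (X : ℤ → Ω → S) (k : ℕ) : ℝ≥0∞ :=
  ⨆ l : ℕ, ⨆ _ : 1 ≤ l,
    ∫⁻ ω, (⨆ B : Set (ℕ → S), ⨆ _ : MeasurableSet B,
      ENNReal.ofReal
        |(condDistrib (tailFrom X (l + k)) (initialBlock X l) μ (initialBlock X l ω)).real B
          - μ.real (tailFrom X (l + k) ⁻¹' B)|) ∂μ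

/-- Exponential mixing rate: `β_k ≤ c * exp (-k ^ r)` for all `k ≥ 1`, for some constants
`c, r > 0`. -/
def IsExponentiallyBetaMixing {Ω S : Type*} [MeasurableSpace Ω] [MeasurableSpace S]
    [StandardBorelSpace S] [Nonempty S] (μ : Measure Ω) [IsFiniteMeasure μ]
    (X : ℤ → Ω → S) : Prop :=
  ∃ c r : ℝ, 0 < c ∧ 0 < r ∧
    ∀ k : ℕ, 1 ≤ k → betaCoeff μ X k ≤ ENNReal.ofReal (c * Real.exp (-((k : ℝ) ^ r)))

/-- Windows of `d` vectors of `ℝⁿ`, i.e. `ℝ^{nd}` with its Euclidean norm. -/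
abbrev WindowSpace (n d : ℕ) : Type :=
  PiLp 2 fun _ : Fin d => EuclideanSpace ℝ (Fin n)

/-- The windows all of whose entries lie in the observation space `𝒳`, i.e. `𝒳ᵈ`. -/
def windowSet {n : ℕ} (d : ℕ) (𝒳 : Set (EuclideanSpace ℝ (Fin n))) : Set (WindowSpace n d) :=
  {w | ∀ i, w i ∈ 𝒳}

/-- The window `X_{t-d}^{t-1} = (X_{t-d}, …, X_{t-1})` of the last `d` observations before
time `t`. -/
noncomputable def window {Ω : Type*} {n : ℕ} (X : ℤ → Ω → EuclideanSpace ℝ (Fin n)) (d : ℕ)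
    (t : ℤ) (ω : Ω) : WindowSpace n d :=
  WithLp.toLp 2 fun i : Fin d => X (t - d + (i : ℤ)) ω

/-- The infinite past `(X_{-1}, X_{-2}, …)`. -/
def infinitePast {Ω S : Type*} (X : ℤ → Ω → S) (ω : Ω) : ℕ → S :=
  fun j => X (-1 - (j : ℤ)) ω

/-- The memory of the process is bounded by `d`: almost surely, the conditional distribution
of `X₀` given the infinite past is the one given the last `d` observations. -/
def HasMemoryBoundedBy {Ω : Type*} [MeasurableSpace Ω] {n : ℕ} (μ : Measure Ω)
    [IsFiniteMeasure μ] (X : ℤ → Ω → EuclideanSpace ℝ (Fin n)) (d : ℕ) : Prop :=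
  ∀ᵐ ω ∂μ, condDistrib (X 0) (infinitePast X) μ (infinitePast X ω)
    = condDistrib (X 0) (window X d 0) μ (window X d 0 ω)

/-- The optimal quantity `L* = 𝔼 [ min_{y ∈ 𝒴} 𝔼_{ℙ_∞} [u(y, X₀)] ]`, where `ℙ_∞` is the regular
conditional distribution of `X₀` given the infinite past. -/
noncomputable def optimalLoss {Ω : Type*} [MeasurableSpace Ω] {n m : ℕ} (μ : Measure Ω)
    [IsFiniteMeasure μ] (X : ℤ → Ω → EuclideanSpace ℝ (Fin n))
    (𝒴 : Set (EuclideanSpace ℝ (Fin m)))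
    (u : EuclideanSpace ℝ (Fin m) → EuclideanSpace ℝ (Fin n) → ℝ) : ℝ :=
  ∫ ω, (⨅ y : 𝒴, ∫ x, u y x ∂(condDistrib (X 0) (infinitePast X) μ (infinitePast X ω))) ∂μ

/-- The functions `𝒳ᵈ → 𝒴` with Lipschitz constant at most `L`
(values outside `𝒳ᵈ` are irrelevant). -/
def lipschitzClass {n m : ℕ} (d : ℕ) (𝒳 : Set (EuclideanSpace ℝ (Fin n)))
    (𝒴 : Set (EuclideanSpace ℝ (Fin m))) (L : ℝ≥0) :
    Set (WindowSpace n d → EuclideanSpace ℝ (Fin m)) :=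
  {g | LipschitzOnWith L g (windowSet d 𝒳) ∧ Set.MapsTo g (windowSet d 𝒳) 𝒴}

/-- The average (empirical) loss `(1/T) ∑_{t=1}^T u(g(X_{t-d}^{t-1}), X_t)` of `g` along the
realization `ω`. -/
noncomputable def averageLoss {Ω : Type*} {n m : ℕ} (X : ℤ → Ω → EuclideanSpace ℝ (Fin n)) (d : ℕ)
    (u : EuclideanSpace ℝ (Fin m) → EuclideanSpace ℝ (Fin n) → ℝ)
    (g : WindowSpace n d → EuclideanSpace ℝ (Fin m)) (T : ℕ) (ω : Ω) : ℝ :=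
  (1 / (T : ℝ)) * ∑ t ∈ Finset.Icc 1 T, u (g (window X d (t : ℤ) ω)) (X (t : ℤ) ω)

/-! Replace `u` by a bounded, globally Lipschitz extension `v`, and let φ(w) be the infimum over 𝒴
of the conditional mean loss given that the last `d` observations form the window w
(`minWindowMean`). Bounded memory gives L* = 𝔼 φ(X_{-d}, …, X_{-1}), and by Birkhoff's theorem the
time averages of φ along the windows tend to L*. The two inequalities are then proved separately.

Upper bound: a near-optimal measurable decision rule can be smoothed, in L¹ of the law of the
window, into a Lipschitz 𝒴-valued rule g whose expected loss is close to L*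
(`exists_lipschitzWith_integral_le`). Since L_T → ∞, g eventually competes with f_T, and its average
loss converges by the ergodic theorem.

Lower bound: f_T depends on the data, so an estimate uniform over the Lipschitz class is needed
(`ae_eventually_average_minWindowMean_le`). On each cell of a fine grid a Lipschitz function is
nearly constant, hence close to a point of a finite net of 𝒴 (`sum_minWindowMean_le`). For a fixed
cell and net point, the losses centred at their conditional means are orthogonal in time by bounded
memory, so their sum up to T has second moment O(T). The number of cells is polynomial in the
inverse mesh, and a polylogarithmic L_T allows a mesh of order T^(-1/s) with s = 2dn + 2. The total
deviation divided by T then has summable second moments along T = (j+1)^s. Consecutive such times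
have ratio tending to 1, so boundedness of the loss fills the gaps. -/

/-! ### Birkhoff's pointwise ergodic theorem, by running maxima. -/

section Birkhoff

variable {α : Type*} {T : α → α} {f : α → ℝ}

/-- The running maximum `max (0, S₁, …, Sₙ)` of the Birkhoff sums of `f`. -/
noncomputable def birkhoffMax (T : α → α) (f : α → ℝ) : ℕ → α → ℝ
  | 0, _ => 0
  | n + 1, x => max 0 (f x + birkhoffMax T f n (T x))

lemma birkhoffMax_nonneg (n : ℕ) (x : α) : 0 ≤ birkhoffMax T f n x := by
  cases n <;> simp [birkhoffMax]

lemma birkhoffMax_le_succ (n : ℕ) : ∀ x, birkhoffMax T f n x ≤ birkhoffMax T f (n + 1) x := by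
  induction n with
  | zero => exact fun x => birkhoffMax_nonneg 1 x
  | succ n ih =>
    intro x
    exact max_le_max le_rfl (by gcongr; exact ih (T x))

lemma birkhoffMax_mono (x : α) : Monotone fun n => birkhoffMax T f n x :=
  monotone_nat_of_le_succ fun n => birkhoffMax_le_succ n x

lemma birkhoffSum_le_birkhoffMax (n : ℕ) : ∀ x, birkhoffSum T f n x ≤ birkhoffMax T f n x := by
  induction n with
  | zero => intro x; simp [birkhoffMax]
  | succ n ih =>
    intro x
    rw [birkhoffSum_succ']
    exact le_max_of_le_right (by gcongr; exact ih (T x))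

/-- The recursion changes the maxima at `T x` only by the finite number `f x` and a truncation at 0.
Hence the set of boundedness is exactly invariant, and ergodicity applies to it. -/
lemma bddAbove_range_birkhoffMax_comp_iff (x : α) :
    BddAbove (Set.range fun n => birkhoffMax T f n (T x)) ↔
      BddAbove (Set.range fun n => birkhoffMax T f n x) := by
  constructor
  · rintro ⟨C, hC⟩
    refine ⟨max 0 (f x + C), ?_⟩
    rintro _ ⟨n, rfl⟩
    refine (birkhoffMax_le_succ n x).trans (max_le_max le_rfl ?_)
    gcongr
    exact hC ⟨n, rfl⟩
  · rintro ⟨C, hC⟩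
    refine ⟨C - f x, ?_⟩
    rintro _ ⟨n, rfl⟩
    have h : birkhoffMax T f (n + 1) x ≤ C := hC ⟨n + 1, rfl⟩
    have h' : f x + birkhoffMax T f n (T x) ≤ birkhoffMax T f (n + 1) x := le_max_right _ _
    change birkhoffMax T f n (T x) ≤ C - f x
    linarith

variable [MeasurableSpace α] {μ : Measure α}

lemma measurable_birkhoffMax (hT : Measurable T) (hf : Measurable f) (n : ℕ) :
    Measurable (birkhoffMax T f n) := by
  induction n with
  | zero => exact measurable_const
  | succ n ih => exact measurable_const.max (hf.add (ih.comp hT))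

lemma integrable_birkhoffMax [IsFiniteMeasure μ] (hT : MeasurePreserving T μ μ)
    (hfi : Integrable f μ) (n : ℕ) : Integrable (birkhoffMax T f n) μ := by
  induction n with
  | zero => exact integrable_const 0
  | succ n ih =>
    exact (integrable_const 0).sup (hfi.add (hT.integrable_comp_of_integrable ih))

/-- If `f` has negative mean then its Birkhoff sums are almost surely bounded above. -/
lemma Ergodic.ae_bddAbove_birkhoffSum [IsFiniteMeasure μ] (hT : Ergodic T μ) (hf : Measurable f)
    (hfi : Integrable f μ) (hneg : ∫ x, f x ∂μ < 0) :
    ∀ᵐ x ∂μ, BddAbove (Set.range fun n => birkhoffSum T f n x) := by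
  have hmeas := hT.toMeasurePreserving.measurable
  have hset : MeasurableSet {x | BddAbove (Set.range fun n => birkhoffMax T f n x)} :=
    measurableSet_bddAbove_range fun n => measurable_birkhoffMax hmeas hf n
  have hinv : T ⁻¹' {x | BddAbove (Set.range fun n => birkhoffMax T f n x)} =
      {x | BddAbove (Set.range fun n => birkhoffMax T f n x)} := by
    ext x
    exact bddAbove_range_birkhoffMax_comp_iff x
  rcases hT.ae_mem_or_ae_notMem hset hinv with h | h
  · filter_upwards [h] with x hx
    obtain ⟨C, hC⟩ := hx
    refine ⟨C, ?_⟩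
    rintro _ ⟨n, rfl⟩
    exact (birkhoffSum_le_birkhoffMax n x).trans (hC ⟨n, rfl⟩)
  -- If the maxima were almost surely unbounded, the differences below would tend to `f`. Their
  -- integrals are nonnegative, by invariance of `μ` and monotonicity in `n`, which would force `f`
  -- to have nonnegative mean.
  · exfalso
    have hincr : ∀ n x, birkhoffMax T f (n + 1) x - birkhoffMax T f n (T x) =
        max (-birkhoffMax T f n (T x)) (f x) := by
      intro n x
      change max 0 (f x + birkhoffMax T f n (T x)) - _ = _
      rw [max_sub_sub_right 0 _ _ |>.symm]
      simp
    have hint : ∀ n, 0 ≤ ∫ x, max (-birkhoffMax T f n (T x)) (f x) ∂μ := by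
      intro n
      have hMi := integrable_birkhoffMax hT.toMeasurePreserving hfi
      have hcomp : ∫ x, birkhoffMax T f n (T x) ∂μ = ∫ x, birkhoffMax T f n x ∂μ := by
        conv_rhs => rw [← hT.toMeasurePreserving.map_eq]
        rw [integral_map hmeas.aemeasurable
          (measurable_birkhoffMax hmeas hf n).aestronglyMeasurable]
      have hsub : ∫ x, birkhoffMax T f (n + 1) x - birkhoffMax T f n (T x) ∂μ =
          ∫ x, birkhoffMax T f (n + 1) x ∂μ - ∫ x, birkhoffMax T f n (T x) ∂μ :=
        integral_sub (hMi (n + 1)) (hT.toMeasurePreserving.integrable_comp_of_integrable (hMi n))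
      simp_rw [← hincr]
      rw [hsub, hcomp, sub_nonneg]
      exact integral_mono (hMi n) (hMi (n + 1)) fun x => birkhoffMax_le_succ n x
    have hlim : Tendsto (fun n => ∫ x, max (-birkhoffMax T f n (T x)) (f x) ∂μ) atTop
        (𝓝 (∫ x, f x ∂μ)) := by
      refine tendsto_integral_of_dominated_convergence (fun x => |f x|) (fun n => ?_) hfi.abs
        (fun n => ?_) ?_
      · exact ((((measurable_birkhoffMax hmeas hf n).comp hmeas).neg).max hf).aestronglyMeasurable
      · refine ae_of_all _ fun x => ?_
        have h0 := birkhoffMax_nonneg (T := T) (f := f) n (T x)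
        rw [Real.norm_eq_abs, abs_le]
        exact ⟨(neg_abs_le _).trans (le_max_right _ _),
          max_le (by linarith [abs_nonneg (f x)]) (le_abs_self _)⟩
      · filter_upwards [h] with x hx
        have hx' : ¬BddAbove (Set.range fun n => birkhoffMax T f n (T x)) :=
          fun hb => hx ((bddAbove_range_birkhoffMax_comp_iff x).1 hb)
        have htop := tendsto_atTop_atTop_of_monotone' (birkhoffMax_mono (T := T) (f := f) (T x)) hx'
        refine tendsto_const_nhds.congr' ?_
        filter_upwards [htop.eventually_ge_atTop (-f x)] with n hn
        exact (max_eq_right (by linarith)).symm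
    linarith [ge_of_tendsto' hlim hint]

/-- Subtracting the mean plus ε/2 leaves a function of negative mean, whose sums are bounded above.
Division by `n` makes that bound smaller than the remaining ε/2. -/
lemma Ergodic.ae_eventually_birkhoffAverage_lt [IsProbabilityMeasure μ] (hT : Ergodic T μ)
    (hf : Measurable f) (hfi : Integrable f μ) {ε : ℝ} (hε : 0 < ε) :
    ∀ᵐ x ∂μ, ∀ᶠ n : ℕ in atTop, birkhoffAverage ℝ T f n x < (∫ x, f x ∂μ) + ε := by
  set c : ℝ := (∫ x, f x ∂μ) + ε / 2 with hc
  have hb := hT.ae_bddAbove_birkhoffSum (f := fun x => f x - c) (hf.sub_const c)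
    (hfi.sub (integrable_const c))
    (by rw [integral_sub hfi (integrable_const c)]; simp [hc]; linarith)
  filter_upwards [hb] with x hx
  obtain ⟨C, hC⟩ := hx
  filter_upwards [(tendsto_natCast_atTop_atTop (R := ℝ)).eventually_gt_atTop (2 * C / ε),
    eventually_gt_atTop 0] with n hn hn0
  have hn0' : (0 : ℝ) < n := by exact_mod_cast hn0
  have h1 : birkhoffSum T (fun x => f x - c) n x ≤ C := hC ⟨n, rfl⟩
  have h2 : birkhoffSum T (fun x => f x - c) n x = birkhoffSum T f n x - n * c := by
    simp [birkhoffSum, Finset.sum_sub_distrib]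
  rw [birkhoffAverage, smul_eq_mul, inv_mul_lt_iff₀ hn0']
  rw [div_lt_iff₀ hε] at hn
  nlinarith

/-- Birkhoff's pointwise ergodic theorem for an ergodic transformation. -/
theorem Ergodic.ae_tendsto_birkhoffAverage [IsProbabilityMeasure μ] (hT : Ergodic T μ)
    (hf : Measurable f) (hfi : Integrable f μ) :
    ∀ᵐ x ∂μ, Tendsto (fun n => birkhoffAverage ℝ T f n x) atTop (𝓝 (∫ x, f x ∂μ)) := by
  have hup : ∀ᵐ x ∂μ, ∀ k : ℕ, ∀ᶠ n : ℕ in atTop,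
      birkhoffAverage ℝ T f n x < (∫ x, f x ∂μ) + 1 / ((k : ℝ) + 1) :=
    ae_all_iff.2 fun k => hT.ae_eventually_birkhoffAverage_lt hf hfi Nat.one_div_pos_of_nat
  have hlo : ∀ᵐ x ∂μ, ∀ k : ℕ, ∀ᶠ n : ℕ in atTop,
      birkhoffAverage ℝ T (-f) n x < (∫ x, (-f) x ∂μ) + 1 / ((k : ℝ) + 1) :=
    ae_all_iff.2 fun k => hT.ae_eventually_birkhoffAverage_lt hf.neg hfi.neg
      Nat.one_div_pos_of_nat
  filter_upwards [hup, hlo] with x h1 h2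
  rw [Metric.tendsto_atTop']
  intro ε hε
  obtain ⟨k, hk⟩ := exists_nat_one_div_lt hε
  obtain ⟨N, hN⟩ := eventually_atTop.1 ((h1 k).and (h2 k))
  refine ⟨N, fun n hn => ?_⟩
  obtain ⟨a, b⟩ := hN n hn.le
  rw [birkhoffAverage_neg] at b
  simp only [Pi.neg_apply, integral_neg] at b
  rw [Real.dist_eq, abs_lt]
  constructor <;> linarith

end Birkhoff

/-! ### Shift invariance and the ergodic theorem for functionals of the process. -/

section StationaryProcess

lemma iterate_shift {S : Type*} (x : ℤ → S) (k : ℕ) :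
    (fun (x : ℤ → S) (t : ℤ) => x (t + 1))^[k] x = fun t => x (t + k) := by
  induction k with
  | zero => simp
  | succ k ih =>
    rw [Function.iterate_succ_apply', ih]
    funext t
    push_cast
    congr 1
    ring

variable {Ω S : Type*} [MeasurableSpace Ω] [MeasurableSpace S] {μ : Measure Ω} {X : ℤ → Ω → S}

lemma measurable_path (hX : ∀ t, Measurable (X t)) : Measurable fun ω t => X t ω :=
  measurable_pi_lambda _ hX

/-- Expectations of functionals of a stationary process are invariant under time shifts. -/
lemma IsStationaryErgodicProcess.integral_shift (hXerg : IsStationaryErgodicProcess μ X)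
    (hX : ∀ t, Measurable (X t)) {G : (ℤ → S) → ℝ} (hG : Measurable G) (k : ℕ) :
    ∫ ω, G (fun s => X (s + k) ω) ∂μ = ∫ ω, G (fun s => X s ω) ∂μ := by
  have hp := measurable_path hX
  have hmp := hXerg.toMeasurePreserving.iterate k
  have h1 : ∫ x, G ((fun (x : ℤ → S) (t : ℤ) => x (t + 1))^[k] x) ∂(μ.map fun ω t => X t ω) =
      ∫ x, G x ∂(μ.map fun ω t => X t ω) := by
    conv_rhs => rw [← hmp.map_eq]
    rw [integral_map hmp.measurable.aemeasurable hG.aestronglyMeasurable]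
  rw [integral_map hp.aemeasurable hG.aestronglyMeasurable,
    integral_map (f := fun x => G ((fun (x : ℤ → S) (t : ℤ) => x (t + 1))^[k] x)) hp.aemeasurable
      (hG.comp hmp.measurable).aestronglyMeasurable] at h1
  simpa only [iterate_shift] using h1

/-- The ergodic theorem for bounded functionals along the trajectories of a stationary ergodic
process. -/
lemma IsStationaryErgodicProcess.ae_tendsto_average [IsProbabilityMeasure μ]
    (hXerg : IsStationaryErgodicProcess μ X)
    (hX : ∀ t, Measurable (X t)) {G : (ℤ → S) → ℝ} (hG : Measurable G) {C : ℝ}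
    (hC : ∀ x, |G x| ≤ C) :
    ∀ᵐ ω ∂μ, Tendsto (fun T : ℕ => (1 / (T : ℝ)) * ∑ t ∈ Finset.Icc 1 T, G (fun s => X (s + t) ω))
      atTop (𝓝 (∫ ω, G (fun s => X s ω) ∂μ)) := by
  have hp := measurable_path hX
  have : IsProbabilityMeasure (μ.map fun ω t => X t ω) :=
    Measure.isProbabilityMeasure_map hp.aemeasurable
  have hshift := hXerg.toMeasurePreserving.measurable
  -- Birkhoff sums run over times 0, …, T-1, so one extra shift in the functional gives 1, …, T.
  have hG' : Measurable fun x : ℤ → S => G (fun t => x (t + 1)) := hG.comp hshift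
  have hB := Ergodic.ae_tendsto_birkhoffAverage hXerg hG'
    (Integrable.of_bound hG'.aestronglyMeasurable C (ae_of_all _ fun x => hC _))
  have hint : ∫ x, G (fun t => x (t + 1)) ∂(μ.map fun ω t => X t ω) =
      ∫ ω, G (fun s => X s ω) ∂μ := by
    rw [integral_map hp.aemeasurable hG'.aestronglyMeasurable]
    simpa using hXerg.integral_shift hX hG 1
  rw [hint] at hB
  filter_upwards [ae_of_ae_map hp.aemeasurable hB] with ω hω
  refine hω.congr fun T => ?_
  rw [birkhoffAverage, birkhoffSum, smul_eq_mul, one_div]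
  congr 1
  simp_rw [iterate_shift, add_assoc]
  rw [Finset.range_eq_Ico]
  have h := Finset.sum_Ico_add' (fun t : ℕ => G (fun s => X (s + t) ω)) 0 T 1
  rw [zero_add] at h
  refine Eq.trans (Finset.sum_congr rfl fun t _ => ?_) (h.trans rfl)
  push_cast
  simp only [add_comm (1 : ℤ)]

end StationaryProcess

/-! ### Second moments and almost sure convergence. -/

section SecondMoment

variable {Ω : Type*} [MeasurableSpace Ω] {μ : Measure Ω}

/-- Uniformly bounded orthogonal random variables: the second moment of their sum grows at most
linearly. -/
lemma integral_sq_sum_le_of_orthogonal [IsProbabilityMeasure μ] {ξ : ℕ → Ω → ℝ} {B : ℝ}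
    (hmeas : ∀ t, Measurable (ξ t)) (hB : ∀ t ω, |ξ t ω| ≤ B)
    (horth : ∀ s t, s < t → ∫ ω, ξ s ω * ξ t ω ∂μ = 0) (T : ℕ) :
    ∫ ω, (∑ t ∈ Finset.Icc 1 T, ξ t ω) ^ 2 ∂μ ≤ T * B ^ 2 := by
  have hbd : ∀ s t ω, |ξ s ω * ξ t ω| ≤ B ^ 2 := fun s t ω => by
    rw [abs_mul, sq]
    exact mul_le_mul (hB s ω) (hB t ω) (abs_nonneg _) ((abs_nonneg _).trans (hB s ω))
  have hint : ∀ s t, Integrable (fun ω => ξ s ω * ξ t ω) μ := fun s t =>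
    Integrable.of_bound ((hmeas s).mul (hmeas t)).aestronglyMeasurable (B ^ 2)
      (ae_of_all _ fun ω => hbd s t ω)
  have horth' : ∀ s t, s ≠ t → ∫ ω, ξ s ω * ξ t ω ∂μ = 0 := fun s t hst => by
    rcases lt_or_gt_of_ne hst with h | h
    · exact horth s t h
    · simp_rw [mul_comm (ξ s _)]
      exact horth t s h
  simp_rw [sq (∑ t ∈ Finset.Icc 1 T, ξ t _), Finset.sum_mul_sum]
  rw [integral_finsetSum _ fun s _ => integrable_finsetSum _ fun t _ => hint s t]
  have hrow : ∀ s ∈ Finset.Icc 1 T, ∫ ω, ∑ t ∈ Finset.Icc 1 T, ξ s ω * ξ t ω ∂μ ≤ B ^ 2 := by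
    intro s hs
    rw [integral_finsetSum _ fun t _ => hint s t,
      Finset.sum_eq_single_of_mem s hs fun t _ hts => horth' s t hts.symm]
    calc ∫ ω, ξ s ω * ξ s ω ∂μ ≤ ∫ _, B ^ 2 ∂μ :=
          integral_mono (hint s s) (integrable_const _) fun ω => (le_abs_self _).trans (hbd s s ω)
      _ = B ^ 2 := by simp
  calc _ ≤ ∑ s ∈ Finset.Icc 1 T, B ^ 2 := Finset.sum_le_sum hrow
    _ = T * B ^ 2 := by simp

/-- The second moment of a finite sum of absolute values of sums of orthogonal variables. -/
lemma integral_sq_sum_abs_le [IsProbabilityMeasure μ] {ι : Type*} (I : Finset ι)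
    {Z : ι → Ω → ℝ} {A B : ℝ} (hmeas : ∀ i, Measurable (Z i)) (hB : ∀ i ω, |Z i ω| ≤ B)
    (hA : ∀ i ∈ I, ∫ ω, Z i ω ^ 2 ∂μ ≤ A) :
    ∫ ω, (∑ i ∈ I, |Z i ω|) ^ 2 ∂μ ≤ (I.card : ℝ) ^ 2 * A := by
  have hint : ∀ i, Integrable (fun ω => Z i ω ^ 2) μ := fun i =>
    Integrable.of_bound ((hmeas i).pow_const 2).aestronglyMeasurable (B ^ 2)
      (ae_of_all _ fun ω => by
        rw [Real.norm_eq_abs, abs_pow]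
        exact pow_le_pow_left₀ (abs_nonneg _) (hB i ω) 2)
  calc ∫ ω, (∑ i ∈ I, |Z i ω|) ^ 2 ∂μ ≤ ∫ ω, I.card * ∑ i ∈ I, Z i ω ^ 2 ∂μ := by
        refine integral_mono_of_nonneg (ae_of_all _ fun ω => sq_nonneg _)
          ((integrable_finsetSum _ fun i _ => hint i).const_mul _) (ae_of_all _ fun ω => ?_)
        simpa using sq_sum_le_card_mul_sum_sq (s := I) (f := fun i => |Z i ω|)
    _ = I.card * ∑ i ∈ I, ∫ ω, Z i ω ^ 2 ∂μ := by
        rw [integral_const_mul, integral_finsetSum _ fun i _ => hint i]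
    _ ≤ I.card * ∑ i ∈ I, A := by gcongr with i hi; exact hA i hi
    _ = (I.card : ℝ) ^ 2 * A := by simp; ring

/-- Random variables with summable second moments tend to zero almost surely. -/
lemma ae_tendsto_zero_of_summable_integral_sq {Z : ℕ → Ω → ℝ} (hmeas : ∀ j, Measurable (Z j))
    (hint : ∀ j, Integrable (fun ω => Z j ω ^ 2) μ) {a : ℕ → ℝ} (ha : Summable a)
    (hle : ∀ j, ∫ ω, Z j ω ^ 2 ∂μ ≤ a j) :
    ∀ᵐ ω ∂μ, Tendsto (fun j => Z j ω) atTop (𝓝 0) := by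
  have hm : ∀ j, Measurable fun ω => ENNReal.ofReal (Z j ω ^ 2) := fun j =>
    ((hmeas j).pow_const 2).ennreal_ofReal
  have hfin : ∫⁻ ω, ∑' j, ENNReal.ofReal (Z j ω ^ 2) ∂μ ≠ ∞ := by
    rw [lintegral_tsum fun j => (hm j).aemeasurable]
    refine ne_top_of_le_ne_top ha.tsum_ofReal_ne_top (ENNReal.tsum_le_tsum fun j => ?_)
    rw [← ofReal_integral_eq_lintegral_ofReal (hint j) (ae_of_all _ fun ω => sq_nonneg _)]
    exact ENNReal.ofReal_le_ofReal (hle j)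
  filter_upwards [ae_lt_top (Measurable.tsum hm) hfin] with ω hω
  have h0 := ENNReal.tendsto_atTop_zero_of_tsum_ne_top hω.ne
  have h1 := (ENNReal.tendsto_toReal ENNReal.zero_ne_top).comp h0
  have h2 : Tendsto (fun j => Z j ω ^ 2) atTop (𝓝 0) := by
    refine h1.congr fun j => ?_
    simp [ENNReal.toReal_ofReal (sq_nonneg _)]
  have h3 := (Real.continuous_sqrt.tendsto 0).comp h2
  rw [Real.sqrt_zero] at h3
  rw [tendsto_zero_iff_abs_tendsto_zero]
  exact h3.congr fun j => by simp [Real.sqrt_sq_eq_abs]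

end SecondMoment

/-! ### Conditional means given a window, and orthogonality of the centred losses. -/

section ConditionalMean

variable {Ω : Type*} [MeasurableSpace Ω] {μ : Measure Ω} [IsProbabilityMeasure μ] {n d : ℕ}
  {X : ℤ → Ω → EuclideanSpace ℝ (Fin n)}

lemma measurable_window (hX : ∀ t, Measurable (X t)) (t : ℤ) : Measurable (window X d t) :=
  (PiLp.continuous_toLp 2 fun _ : Fin d => EuclideanSpace ℝ (Fin n)).measurable.comp
    (measurable_pi_lambda _ fun _ => hX _)

/-- The conditional mean of `v X₀` given the window of the last `d` observations. -/
noncomputable def windowMean (μ : Measure Ω) [IsFiniteMeasure μ]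
    (X : ℤ → Ω → EuclideanSpace ℝ (Fin n)) (d : ℕ) (v : EuclideanSpace ℝ (Fin n) → ℝ)
    (w : WindowSpace n d) : ℝ :=
  ∫ x, v x ∂(condDistrib (X 0) (window X d 0) μ w)

lemma measurable_windowMean {v : EuclideanSpace ℝ (Fin n) → ℝ} (hv : Measurable v) :
    Measurable (windowMean μ X d v) :=
  (hv.stronglyMeasurable.comp_measurable measurable_snd).integral_condDistrib.measurable

lemma abs_windowMean_le {v : EuclideanSpace ℝ (Fin n) → ℝ} {C : ℝ} (hC : ∀ x, |v x| ≤ C)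
    (w : WindowSpace n d) : |windowMean μ X d v w| ≤ C := by
  simpa [windowMean] using norm_integral_le_of_norm_le_const
    (μ := condDistrib (X 0) (window X d 0) μ w) (f := v) (C := C) (ae_of_all _ hC)

/-- Conditioning on the infinite past leaves `H` fixed and replaces `v X₀` by its mean under the
kernel of the past, which bounded memory identifies with the kernel of the window. -/
lemma integral_past_mul_innovation_zero (hX : ∀ t, Measurable (X t))
    (hXmem : HasMemoryBoundedBy μ X d) {H : (ℕ → EuclideanSpace ℝ (Fin n)) → ℝ}
    (hH : Measurable H) {B : ℝ} (hB : ∀ p, |H p| ≤ B) {v : EuclideanSpace ℝ (Fin n) → ℝ}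
    (hv : Measurable v) {C : ℝ} (hC : ∀ x, |v x| ≤ C) :
    ∫ ω, H (infinitePast X ω) * (v (X 0 ω) - windowMean μ X d v (window X d 0 ω)) ∂μ = 0 := by
  have hpast : Measurable (infinitePast X) := measurable_pi_lambda _ fun _ => hX _
  have hB0 : 0 ≤ B := (abs_nonneg _).trans (hB fun _ => 0)
  have hi1 : Integrable (fun ω => H (infinitePast X ω) * v (X 0 ω)) μ :=
    Integrable.of_bound ((hH.comp hpast).mul (hv.comp (hX 0))).aestronglyMeasurable (B * C)
      (ae_of_all _ fun ω => by
        rw [Real.norm_eq_abs, abs_mul]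
        exact mul_le_mul (hB _) (hC _) (abs_nonneg _) hB0)
  have hi2 : Integrable (fun ω => H (infinitePast X ω) * windowMean μ X d v (window X d 0 ω)) μ :=
    Integrable.of_bound ((hH.comp hpast).mul
      ((measurable_windowMean hv).comp (measurable_window hX 0))).aestronglyMeasurable (B * C)
      (ae_of_all _ fun ω => by
        rw [Real.norm_eq_abs, abs_mul]
        exact mul_le_mul (hB _) (abs_windowMean_le hC _) (abs_nonneg _) hB0)
  have hce := condExp_prod_ae_eq_integral_condDistrib (μ := μ) hpast (hX 0).aemeasurable
    (f := fun q : (ℕ → EuclideanSpace ℝ (Fin n)) × EuclideanSpace ℝ (Fin n) => H q.1 * v q.2)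
    ((hH.comp measurable_fst).mul (hv.comp measurable_snd)).stronglyMeasurable hi1
  have heq : ∫ ω, H (infinitePast X ω) * v (X 0 ω) ∂μ =
      ∫ ω, H (infinitePast X ω) * windowMean μ X d v (window X d 0 ω) ∂μ := by
    rw [← integral_condExp hpast.comap_le]
    refine integral_congr_ae ?_
    filter_upwards [hce, hXmem] with ω h1 h2
    rw [h1, windowMean, ← h2]
    exact integral_const_mul _ _
  simp_rw [mul_sub]
  rw [integral_sub hi1 hi2, heq, sub_self]

/-- Under bounded memory, `v X_t` minus its conditional mean given the last `d` observations is
orthogonal to every bounded function of the past of time `t`. -/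
lemma integral_past_mul_innovation (hX : ∀ t, Measurable (X t))
    (hXerg : IsStationaryErgodicProcess μ X)
    (hXmem : HasMemoryBoundedBy μ X d) {H : (ℕ → EuclideanSpace ℝ (Fin n)) → ℝ}
    (hH : Measurable H) {B : ℝ} (hB : ∀ p, |H p| ≤ B) {v : EuclideanSpace ℝ (Fin n) → ℝ}
    (hv : Measurable v) {C : ℝ} (hC : ∀ x, |v x| ≤ C) (t : ℕ) :
    ∫ ω, H (fun j => X (t - 1 - j) ω) *
      (v (X t ω) - windowMean μ X d v (window X d t ω)) ∂μ = 0 := by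
  rw [← integral_past_mul_innovation_zero hX hXmem hH hB hv hC]
  have hcoord : ∀ t : ℤ, Measurable fun x : ℤ → EuclideanSpace ℝ (Fin n) => x t :=
    fun t => measurable_pi_apply t
  -- The integrand is one functional on path space, evaluated at the shifted path. The conditional
  -- mean remains the fixed function of the window defined at time 0.
  have hG : Measurable fun x : ℤ → EuclideanSpace ℝ (Fin n) =>
      H (fun j => x (-1 - j)) *
        (v (x 0) - windowMean μ X d v (window (fun t x => x t) d 0 x)) :=
    (hH.comp (measurable_pi_lambda _ fun j => hcoord _)).mul ((hv.comp (hcoord 0)).sub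
      ((measurable_windowMean hv).comp (measurable_window hcoord 0)))
  refine Eq.trans (integral_congr_ae (ae_of_all _ fun ω => ?_)) (hXerg.integral_shift hX hG t)
  have h1 : ∀ j : ℕ, (-1 - (j : ℤ) + t) = t - 1 - j := fun j => by ring
  have h2 : window (fun t (x : ℤ → EuclideanSpace ℝ (Fin n)) => x t) d 0
      (fun s => X (s + t) ω) = window X d t ω := by
    simp only [window]
    congr 1
    funext i
    congr 1
    ring
  simp only [h1, h2, zero_add]

/-- The centred loss `v X_t` localized to the event that the window before `t` lies in `c`. -/
noncomputable def localInnovation (μ : Measure Ω) [IsFiniteMeasure μ]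
    (X : ℤ → Ω → EuclideanSpace ℝ (Fin n)) (d : ℕ) (v : EuclideanSpace ℝ (Fin n) → ℝ)
    (c : Set (WindowSpace n d)) (t : ℤ) (ω : Ω) : ℝ :=
  c.indicator 1 (window X d t ω) * (v (X t ω) - windowMean μ X d v (window X d t ω))

lemma measurable_localInnovation (hX : ∀ t, Measurable (X t))
    {v : EuclideanSpace ℝ (Fin n) → ℝ} (hv : Measurable v) {c : Set (WindowSpace n d)}
    (hc : MeasurableSet c) (t : ℤ) : Measurable (localInnovation μ X d v c t) :=
  ((measurable_one.indicator hc).comp (measurable_window hX t)).mul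
    ((hv.comp (hX t)).sub ((measurable_windowMean hv).comp (measurable_window hX t)))

lemma abs_indicator_one_le {α : Type*} (c : Set α) (x : α) :
    |c.indicator (1 : α → ℝ) x| ≤ 1 := by
  by_cases h : x ∈ c <;> simp [h]

lemma abs_indicator_mul_sub_le {α : Type*} (c : Set α) (w : α) {a b C : ℝ} (ha : |a| ≤ C)
    (hb : |b| ≤ C) : |c.indicator (1 : α → ℝ) w * (a - b)| ≤ 2 * C := by
  rw [abs_mul, ← one_mul (2 * C)]
  exact mul_le_mul (abs_indicator_one_le c w) ((abs_sub a b).trans (by linarith))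
    (abs_nonneg _) zero_le_one

lemma abs_localInnovation_le {v : EuclideanSpace ℝ (Fin n) → ℝ} {C : ℝ} (hC : ∀ x, |v x| ≤ C)
    (c : Set (WindowSpace n d)) (t : ℤ) (ω : Ω) : |localInnovation μ X d v c t ω| ≤ 2 * C :=
  abs_indicator_mul_sub_le _ _ (hC _) (abs_windowMean_le hC _)

/-- For s < t, the whole factor at time `s` and the indicator at time `t` are bounded functions of
the past of `t`, so the innovation at `t` is orthogonal to their product. -/
lemma integral_localInnovation_mul (hX : ∀ t, Measurable (X t))
    (hXerg : IsStationaryErgodicProcess μ X)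
    (hXmem : HasMemoryBoundedBy μ X d) {v : EuclideanSpace ℝ (Fin n) → ℝ}
    (hv : Measurable v) {C : ℝ} (hC : ∀ x, |v x| ≤ C) {c : Set (WindowSpace n d)}
    (hc : MeasurableSet c) (s t : ℕ) (hst : s < t) :
    ∫ ω, localInnovation μ X d v c s ω * localInnovation μ X d v c t ω ∂μ = 0 := by
  -- Recovers `X r` from the past of `t`. The truncation in `toNat` is harmless, since only times `r
  -- < t` are read.
  let Y : ℤ → (ℕ → EuclideanSpace ℝ (Fin n)) → EuclideanSpace ℝ (Fin n) :=
    fun r p => p (t - 1 - r).toNat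
  have hY : ∀ r, Measurable (Y r) := fun r => measurable_pi_apply _
  have hYX : ∀ (r : ℤ) (ω : Ω), r < t → Y r (fun j => X (t - 1 - j) ω) = X r ω := by
    intro r ω hr
    simp only [Y]
    congr 1
    rw [Int.toNat_of_nonneg (by linarith)]
    ring
  have hYw : ∀ (r : ℤ) (ω : Ω), r ≤ t →
      window Y d r (fun j => X (t - 1 - j) ω) = window X d r ω := by
    intro r ω hr
    simp only [window]
    congr 1
    funext i
    refine hYX _ ω ?_
    have := i.2
    omega
  have hsw := measurable_window (d := d) hY s
  have htw := measurable_window (d := d) hY t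
  have h1 : Measurable (c.indicator (1 : WindowSpace n d → ℝ)) := measurable_one.indicator hc
  have hH : Measurable fun p : ℕ → EuclideanSpace ℝ (Fin n) =>
      (c.indicator 1 (window Y d s p) * (v (Y s p) - windowMean μ X d v (window Y d s p))) *
        c.indicator 1 (window Y d t p) :=
    ((h1.comp hsw).mul ((hv.comp (hY s)).sub ((measurable_windowMean hv).comp hsw))).mul
      (h1.comp htw)
  rw [← integral_past_mul_innovation hX hXerg hXmem hH (B := 2 * C) (fun p => ?_) hv hC t]
  · refine integral_congr_ae (ae_of_all _ fun ω => ?_)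
    simp only [localInnovation]
    rw [hYw s ω (by omega), hYw t ω le_rfl, hYX s ω (by omega)]
    ring
  · rw [abs_mul, ← mul_one (2 * C)]
    have h2 := abs_indicator_mul_sub_le c (window Y d s p) (hC (Y s p))
      (abs_windowMean_le (μ := μ) (X := X) hC (window Y d s p))
    exact mul_le_mul h2 (abs_indicator_one_le _ _) (abs_nonneg _) ((abs_nonneg _).trans h2)

end ConditionalMean

/-! ### Grid cells in window space. -/

section Cells

lemma PiLp.norm_le_sum_norm {ι : Type*} [Fintype ι] {β : ι → Type*}
    [∀ i, SeminormedAddCommGroup (β i)] (x : PiLp 2 β) : ‖x‖ ≤ ∑ i, ‖x i‖ := by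
  rw [PiLp.norm_eq_of_L2]
  exact Real.sqrt_le_iff.2 ⟨Finset.sum_nonneg fun i _ => norm_nonneg _,
    Finset.sum_sq_le_sq_sum_of_nonneg fun i _ => norm_nonneg _⟩

variable {n d : ℕ}

/-- The index of the cell of the grid of mesh `1 / M` that contains the window `w`. -/
noncomputable def cellIndex (M : ℕ) (w : WindowSpace n d) : Fin d → Fin n → ℤ :=
  fun i j => ⌊(M : ℝ) * w i j⌋

/-- The cell with index `a` of the grid of mesh `1 / M`. -/
def gridCell (M : ℕ) (a : Fin d → Fin n → ℤ) : Set (WindowSpace n d) :=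
  {w | cellIndex M w = a}

lemma measurableSet_gridCell (M : ℕ) (a : Fin d → Fin n → ℤ) :
    MeasurableSet (gridCell M a : Set (WindowSpace n d)) := by
  have h : Measurable (cellIndex M : WindowSpace n d → Fin d → Fin n → ℤ) := by
    refine measurable_pi_lambda _ fun i => measurable_pi_lambda _ fun j => ?_
    refine Measurable.floor (Continuous.measurable ?_)
    fun_prop
  exact h (measurableSet_singleton a)

lemma dist_le_of_cellIndex_eq {M : ℕ} (hM : 0 < M) {w w' : WindowSpace n d}
    (h : cellIndex M w = cellIndex M w') : dist w w' ≤ d * n / M := by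
  have hM' : (0 : ℝ) < M := by exact_mod_cast hM
  have hcoord : ∀ i j, ‖(w - w') i j‖ ≤ 1 / M := by
    intro i j
    have hfl : ⌊(M : ℝ) * w i j⌋ = ⌊(M : ℝ) * w' i j⌋ := congrFun (congrFun h i) j
    have h1 := Int.abs_sub_lt_one_of_floor_eq_floor hfl
    rw [← mul_sub, abs_mul, abs_of_pos hM'] at h1
    rw [le_div_iff₀ hM', mul_comm]
    exact h1.le
  rw [dist_eq_norm]
  calc ‖w - w'‖ ≤ ∑ i, ‖(w - w') i‖ := PiLp.norm_le_sum_norm _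
    _ ≤ ∑ i, ∑ j, ‖(w - w') i j‖ := Finset.sum_le_sum fun i _ => PiLp.norm_le_sum_norm _
    _ ≤ ∑ _i : Fin d, ∑ _j : Fin n, (1 / M : ℝ) :=
        Finset.sum_le_sum fun i _ => Finset.sum_le_sum fun j _ => hcoord i j
    _ = d * n / M := by simp; ring

/-- The indices of the cells of mesh `1 / M` that meet the windows with entries of norm at most
`R`. -/
noncomputable def gridIndices (n d R M : ℕ) : Finset (Fin d → Fin n → ℤ) :=
  Fintype.piFinset fun _ => Fintype.piFinset fun _ => Finset.Icc (-(R * M : ℤ)) (R * M)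

lemma card_gridIndices (n d R M : ℕ) : (gridIndices n d R M).card = (2 * R * M + 1) ^ (d * n) := by
  have h : (R * M + 1 + (R * M : ℤ)).toNat = 2 * R * M + 1 := by
    have : (R * M + 1 + (R * M : ℤ)) = ((2 * R * M + 1 : ℕ) : ℤ) := by push_cast; ring
    rw [this, Int.toNat_natCast]
  simp [gridIndices, Int.card_Icc, h, ← pow_mul, mul_comm n d]

lemma cellIndex_mem_gridIndices {R : ℕ} (M : ℕ) {w : WindowSpace n d} (hw : ∀ i, ‖w i‖ ≤ R) :
    cellIndex M w ∈ gridIndices n d R M := by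
  simp only [gridIndices, Fintype.mem_piFinset, Finset.mem_Icc]
  intro i j
  have h1 : |w i j| ≤ R := (PiLp.norm_apply_le (w i) j).trans (hw i)
  have hM : (0 : ℝ) ≤ M := Nat.cast_nonneg M
  rw [abs_le] at h1
  constructor
  · rw [cellIndex, Int.le_floor]
    push_cast
    nlinarith
  · have : (cellIndex M w i j : ℝ) ≤ R * M := (Int.floor_le _).trans (by nlinarith)
    exact_mod_cast this

lemma window_mem_windowSet {Ω : Type*} {X : ℤ → Ω → EuclideanSpace ℝ (Fin n)}
    {𝒳 : Set (EuclideanSpace ℝ (Fin n))} {ω : Ω} (hX : ∀ t, X t ω ∈ 𝒳) (t : ℤ) :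
    window X d t ω ∈ windowSet d 𝒳 :=
  fun _ => hX _

end Cells

/-! ### Deterministic comparison on a grid, and the size of the deviation. -/

section Pathwise

variable {Ω : Type*} [MeasurableSpace Ω] {μ : Measure Ω} [IsProbabilityMeasure μ] {n m d : ℕ}
  {X : ℤ → Ω → EuclideanSpace ℝ (Fin n)}
  {v : EuclideanSpace ℝ (Fin m) → EuclideanSpace ℝ (Fin n) → ℝ}

/-- The smallest conditional mean loss `min_{y ∈ 𝒴} 𝔼[v y X₀ ∣ X_{-d}, …, X_{-1}]`. -/
noncomputable def minWindowMean (μ : Measure Ω) [IsFiniteMeasure μ]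
    (X : ℤ → Ω → EuclideanSpace ℝ (Fin n)) (d : ℕ) (𝒴 : Set (EuclideanSpace ℝ (Fin m)))
    (v : EuclideanSpace ℝ (Fin m) → EuclideanSpace ℝ (Fin n) → ℝ) (w : WindowSpace n d) : ℝ :=
  ⨅ y : 𝒴, windowMean μ X d (v y) w

lemma minWindowMean_le {C : ℝ} (hC : ∀ y x, |v y x| ≤ C) {𝒴 : Set (EuclideanSpace ℝ (Fin m))}
    {y : EuclideanSpace ℝ (Fin m)} (hy : y ∈ 𝒴) (w : WindowSpace n d) :
    minWindowMean μ X d 𝒴 v w ≤ windowMean μ X d (v y) w :=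
  ciInf_le (f := fun y : 𝒴 => windowMean μ X d (v y) w)
    ⟨-C, Set.forall_mem_range.2 fun y => (abs_le.1 (abs_windowMean_le (hC y) w)).1⟩ ⟨y, hy⟩

lemma abs_minWindowMean_le {C : ℝ} (hC : ∀ y x, |v y x| ≤ C)
    {𝒴 : Set (EuclideanSpace ℝ (Fin m))} (hne : 𝒴.Nonempty) (w : WindowSpace n d) :
    |minWindowMean μ X d 𝒴 v w| ≤ C := by
  obtain ⟨y, hy⟩ := hne
  have : Nonempty 𝒴 := ⟨⟨y, hy⟩⟩
  rw [abs_le]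
  exact ⟨le_ciInf fun y => (abs_le.1 (abs_windowMean_le (hC y) w)).1,
    (minWindowMean_le hC hy w).trans (abs_le.1 (abs_windowMean_le (hC y) w)).2⟩

/-- The total deviation of the centred losses over all cells of the grid of mesh `1 / M` and all
decisions in the finite set `N`. -/
noncomputable def gridDeviation (μ : Measure Ω) [IsFiniteMeasure μ]
    (X : ℤ → Ω → EuclideanSpace ℝ (Fin n)) (d : ℕ)
    (v : EuclideanSpace ℝ (Fin m) → EuclideanSpace ℝ (Fin n) → ℝ) (R : ℕ)
    (N : Finset (EuclideanSpace ℝ (Fin m))) (M T : ℕ) (ω : Ω) : ℝ :=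
  ∑ q ∈ gridIndices n d R M ×ˢ N,
    |∑ t ∈ Finset.Icc 1 T, localInnovation μ X d (v q.2) (gridCell M q.1) t ω|

/-- A function that varies little on the cells of the grid cannot beat the conditionally optimal
decisions by more than the deviation of the centred losses. -/
lemma sum_minWindowMean_le {𝒳 : Set (EuclideanSpace ℝ (Fin n))}
    {𝒴 : Set (EuclideanSpace ℝ (Fin m))} {C K δ : ℝ} (hC : ∀ y x, |v y x| ≤ C) (hK0 : 0 ≤ K)
    (hK : ∀ y y' x, |v y x - v y' x| ≤ K * dist y y') {ω : Ω} (hX : ∀ t, X t ω ∈ 𝒳) {R : ℕ}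
    (hR : ∀ x ∈ 𝒳, ‖x‖ ≤ R) {N : Finset (EuclideanSpace ℝ (Fin m))}
    (hN : ∀ y ∈ N, y ∈ 𝒴) (hNnet : ∀ y ∈ 𝒴, ∃ z ∈ N, dist y z ≤ δ) {M : ℕ} (hM : 0 < M)
    {L : ℝ≥0} (hL : L * (d * n / M) ≤ δ) {g : WindowSpace n d → EuclideanSpace ℝ (Fin m)}
    (hg : g ∈ lipschitzClass d 𝒳 𝒴 L) (T : ℕ) :
    ∑ t ∈ Finset.Icc 1 T, minWindowMean μ X d 𝒴 v (window X d t ω) ≤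
      ∑ t ∈ Finset.Icc 1 T, v (g (window X d t ω)) (X t ω) +
        gridDeviation μ X d v R N M T ω + 2 * K * δ * T := by
  obtain ⟨hgL, hgm⟩ := hg
  have hw := fun t => window_mem_windowSet (d := d) hX t
  -- One δ comes from the net at a reference window of the cell, the other from the oscillation of
  -- `g` on the cell. Cells without admissible windows receive an arbitrary net point.
  have hy : ∀ a : Fin d → Fin n → ℤ, ∃ y ∈ N, ∀ w ∈ windowSet d 𝒳, w ∈ gridCell M a →
      dist y (g w) ≤ 2 * δ := by
    intro a
    by_cases ha : ∃ w ∈ windowSet d 𝒳, w ∈ gridCell M a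
    · obtain ⟨w₀, hw₀, ha₀⟩ := ha
      obtain ⟨y, hyN, hy⟩ := hNnet (g w₀) (hgm hw₀)
      refine ⟨y, hyN, fun w hw hwa => ?_⟩
      have h1 : dist (g w₀) (g w) ≤ δ :=
        (hgL.dist_le_mul _ hw₀ _ hw).trans (le_trans (by
          gcongr
          exact dist_le_of_cellIndex_eq hM (Eq.trans ha₀ (Eq.symm hwa))) hL)
      linarith [dist_triangle_left y (g w) (g w₀)]
    · obtain ⟨y, hyN, -⟩ := hNnet (g (window X d 0 ω)) (hgm (hw 0))
      exact ⟨y, hyN, fun w hw hwa => (ha ⟨w, hw, hwa⟩).elim⟩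
  choose y hyN hy using hy
  set I := gridIndices n d R M with hI
  have hmem : ∀ t : ℤ, cellIndex M (window X d t ω) ∈ I := fun t =>
    cellIndex_mem_gridIndices M fun i => hR _ (hw t i)
  have hterm : ∀ t : ℤ, minWindowMean μ X d 𝒴 v (window X d t ω) ≤
      v (g (window X d t ω)) (X t ω) + 2 * K * δ -
        ∑ a ∈ I, localInnovation μ X d (v (y a)) (gridCell M a) t ω := by
    intro t
    set w := window X d t ω with hwdef
    -- Only the cell containing the current window contributes.
    rw [Finset.sum_eq_single_of_mem _ (hmem t) fun a _ ha => by
      have : w ∉ gridCell M a := fun h => ha (Eq.symm h)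
      simp [localInnovation, ← hwdef, this]]
    set a := cellIndex M w with ha
    have hwa : w ∈ gridCell M a := rfl
    have h1 := minWindowMean_le (μ := μ) (X := X) hC (hN _ (hyN a)) w
    have h2 := hK (y a) (g w) (X t ω)
    have h3 : K * dist (y a) (g w) ≤ K * (2 * δ) := by gcongr; exact hy a w (hw t) hwa
    have h4 : localInnovation μ X d (v (y a)) (gridCell M a) t ω =
        v (y a) (X t ω) - windowMean μ X d (v (y a)) w := by
      simp [localInnovation, ← hwdef, hwa]
    rw [h4]
    linarith [(abs_le.1 (h2.trans h3)).2]
  -- The decisions `y a` depend on `g`, but `gridDeviation` sums absolute values over the whole net,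
  -- so the bound does not.
  have hdev : -∑ a ∈ I, ∑ t ∈ Finset.Icc 1 T,
      localInnovation μ X d (v (y a)) (gridCell M a) t ω ≤ gridDeviation μ X d v R N M T ω := by
    rw [gridDeviation, Finset.sum_product, ← Finset.sum_neg_distrib]
    refine Finset.sum_le_sum fun a _ => (neg_le_abs _).trans ?_
    exact Finset.single_le_sum (f := fun z => |∑ t ∈ Finset.Icc 1 T,
      localInnovation μ X d (v z) (gridCell M a) t ω|) (fun z _ => abs_nonneg _) (hyN a)
  calc _ ≤ ∑ t ∈ Finset.Icc 1 T, (v (g (window X d t ω)) (X t ω) + 2 * K * δ -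
        ∑ a ∈ I, localInnovation μ X d (v (y a)) (gridCell M a) t ω) :=
        Finset.sum_le_sum fun t _ => hterm t
    _ = ∑ t ∈ Finset.Icc 1 T, v (g (window X d t ω)) (X t ω) + T * (2 * K * δ) +
        -∑ a ∈ I, ∑ t ∈ Finset.Icc 1 T,
          localInnovation μ X d (v (y a)) (gridCell M a) t ω := by
        rw [Finset.sum_sub_distrib, Finset.sum_add_distrib, Finset.sum_comm (s := I)]
        simp [sub_eq_add_neg]
    _ ≤ _ := by linarith

lemma measurable_sum_localInnovation (hX : ∀ t, Measurable (X t)) (hv : ∀ y, Measurable (v y))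
    (y : EuclideanSpace ℝ (Fin m)) {c : Set (WindowSpace n d)} (hc : MeasurableSet c) (T : ℕ) :
    Measurable fun ω => ∑ t ∈ Finset.Icc 1 T, localInnovation μ X d (v y) c t ω :=
  Finset.measurable_sum (f := fun (t : ℕ) ω => localInnovation μ X d (v y) c t ω) _
    fun t _ => measurable_localInnovation hX (hv y) hc t

lemma measurable_gridDeviation (hX : ∀ t, Measurable (X t)) (hv : ∀ y, Measurable (v y)) (R : ℕ)
    (N : Finset (EuclideanSpace ℝ (Fin m))) (M T : ℕ) :
    Measurable (gridDeviation μ X d v R N M T) := by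
  unfold gridDeviation
  refine Finset.measurable_sum _ fun q _ => Measurable.abs ?_
  exact measurable_sum_localInnovation hX hv q.2 (measurableSet_gridCell M q.1) T

lemma abs_sum_localInnovation_le {C : ℝ} (hC : ∀ y x, |v y x| ≤ C)
    (q : EuclideanSpace ℝ (Fin m)) (c : Set (WindowSpace n d)) (T : ℕ) (ω : Ω) :
    |∑ t ∈ Finset.Icc 1 T, localInnovation μ X d (v q) c t ω| ≤ T * (2 * C) := by
  refine (Finset.abs_sum_le_sum_abs _ _).trans ?_
  calc _ ≤ ∑ _t ∈ Finset.Icc 1 T, 2 * C :=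
        Finset.sum_le_sum fun t _ => abs_localInnovation_le (hC q) c (t : ℤ) ω
    _ = T * (2 * C) := by simp

/-- Orthogonality bounds each pair of cell and decision by `T * (2 * C) ^ 2`; Cauchy–Schwarz over
the pairs costs the square of their number. -/
lemma integral_gridDeviation_sq_le (hX : ∀ t, Measurable (X t))
    (hXerg : IsStationaryErgodicProcess μ X) (hXmem : HasMemoryBoundedBy μ X d)
    (hv : ∀ y, Measurable (v y)) {C : ℝ} (hC : ∀ y x, |v y x| ≤ C) (R : ℕ)
    (N : Finset (EuclideanSpace ℝ (Fin m))) (M T : ℕ) :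
    ∫ ω, gridDeviation μ X d v R N M T ω ^ 2 ∂μ ≤
      (((2 * R * M + 1) ^ (d * n) : ℕ) * N.card : ℝ) ^ 2 * (T * (2 * C) ^ 2) := by
  have h := integral_sq_sum_abs_le (μ := μ) (gridIndices n d R M ×ˢ N)
    (Z := fun q ω => ∑ t ∈ Finset.Icc 1 T, localInnovation μ X d (v q.2) (gridCell M q.1) t ω)
    (A := T * (2 * C) ^ 2) (B := T * (2 * C))
    (fun q => measurable_sum_localInnovation hX hv q.2 (measurableSet_gridCell M q.1) T)
    (fun q ω => abs_sum_localInnovation_le hC _ _ T ω)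
    (fun q _ => integral_sq_sum_le_of_orthogonal
      (ξ := fun t ω => localInnovation μ X d (v q.2) (gridCell M q.1) t ω)
      (fun t => measurable_localInnovation hX (hv q.2) (measurableSet_gridCell M q.1) t)
      (fun t ω => abs_localInnovation_le (hC q.2) _ _ ω)
      (fun s t hst => integral_localInnovation_mul hX hXerg hXmem (hv q.2) (hC q.2)
        (measurableSet_gridCell M q.1) s t hst) T)
  rw [Finset.card_product, card_gridIndices, Nat.cast_mul] at h
  exact h

lemma integrable_gridDeviation_sq (hX : ∀ t, Measurable (X t))
    (hv : ∀ y, Measurable (v y)) {C : ℝ} (hC : ∀ y x, |v y x| ≤ C) (R : ℕ)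
    (N : Finset (EuclideanSpace ℝ (Fin m))) (M T : ℕ) :
    Integrable (fun ω => gridDeviation μ X d v R N M T ω ^ 2) μ := by
  refine Integrable.of_bound
    ((measurable_gridDeviation hX hv R N M T).pow_const 2).aestronglyMeasurable
    ((∑ _q ∈ gridIndices n d R M ×ˢ N, T * (2 * C)) ^ 2) (ae_of_all _ fun ω => ?_)
  rw [Real.norm_eq_abs, abs_pow]
  refine pow_le_pow_left₀ (abs_nonneg _) ?_ 2
  rw [abs_of_nonneg (Finset.sum_nonneg fun q _ => abs_nonneg _)]
  exact Finset.sum_le_sum fun q _ => abs_sum_localInnovation_le hC _ _ T ω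

end Pathwise

/-! ### The uniform almost sure lower bound. -/

section LowerBound

lemma sum_Icc_le_add_mul {a : ℕ → ℝ} {B : ℝ} (ha : ∀ t, a t ≤ B) {S T : ℕ} (hST : S ≤ T) :
    ∑ t ∈ Finset.Icc 1 T, a t ≤ ∑ t ∈ Finset.Icc 1 S, a t + B * ((T : ℝ) - S) := by
  induction T, hST using Nat.le_induction with
  | base => simp
  | succ T hST ih =>
    rw [Finset.sum_Icc_succ_top (by omega)]
    push_cast
    linarith [ha (T + 1)]

lemma exists_pow_le_lt_pow {s T : ℕ} (hs : s ≠ 0) (hT : 1 ≤ T) :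
    ∃ j : ℕ, (j + 1) ^ s ≤ T ∧ T < (j + 2) ^ s := by
  have hex : ∃ j : ℕ, T < (j + 2) ^ s :=
    ⟨T, (by omega : T < T + 2).trans_le (Nat.le_self_pow hs _)⟩
  classical
  refine ⟨Nat.find hex, ?_, Nat.find_spec hex⟩
  rcases h : Nat.find hex with _ | k
  · simpa using hT
  · exact not_lt.1 (Nat.find_min hex (m := k) (by omega))

/-- A polylogarithmic sequence is eventually dominated by any multiple of a power of `T`. -/
lemma eventually_mul_le_of_isBigO_log {L : ℕ → ℝ≥0} {p : ℝ}
    (hL : (fun T : ℕ => (L T : ℝ)) =O[atTop] fun T : ℕ => Real.log T ^ p) {r δ : ℝ} (hr : 0 < r)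
    (hδ : 0 < δ) (A : ℝ) : ∀ᶠ T : ℕ in atTop, A * L T ≤ δ * (T : ℝ) ^ r := by
  have h1 : (fun T : ℕ => Real.log T ^ p) =o[atTop] fun T : ℕ => (T : ℝ) ^ r :=
    (isLittleO_log_rpow_rpow_atTop p hr).comp_tendsto tendsto_natCast_atTop_atTop
  have h2 := ((hL.trans_isLittleO h1).const_mul_left A).bound hδ
  filter_upwards [h2] with T hT
  refine (le_abs_self _).trans (hT.trans_eq ?_)
  rw [Real.norm_of_nonneg (by positivity)]

lemma tendsto_ratio_pow (s : ℕ) :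
    Tendsto (fun j : ℕ => (((j : ℝ) + 2) / (j + 1)) ^ s - 1) atTop (𝓝 0) := by
  have h : Tendsto (fun j : ℕ => 1 + 1 / ((j : ℝ) + 1)) atTop (𝓝 (1 + 0)) :=
    tendsto_const_nhds.add tendsto_one_div_add_atTop_nhds_zero_nat
  have h' := (h.pow s).sub_const 1
  simp only [add_zero, one_pow, sub_self] at h'
  refine h'.congr fun j => ?_
  have : (j : ℝ) + 1 ≠ 0 := by positivity
  congr 2
  field_simp
  ring

variable {Ω : Type*} [MeasurableSpace Ω] {μ : Measure Ω} [IsProbabilityMeasure μ] {n m d : ℕ}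
  {X : ℤ → Ω → EuclideanSpace ℝ (Fin n)}
  {v : EuclideanSpace ℝ (Fin m) → EuclideanSpace ℝ (Fin n) → ℝ}

/-- With k = dn and T = (j+1)^(2k+2), the squared number of cells is O(j^(2k)) and the normalized
second moment of one sum is O(1/T), so the product is O(1/j²), which is summable. -/
lemma ae_tendsto_gridDeviation_div (hX : ∀ t, Measurable (X t))
    (hXerg : IsStationaryErgodicProcess μ X) (hXmem : HasMemoryBoundedBy μ X d)
    (hv : ∀ y, Measurable (v y)) {C : ℝ} (hC : ∀ y x, |v y x| ≤ C) (R : ℕ)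
    (N : Finset (EuclideanSpace ℝ (Fin m))) :
    ∀ᵐ ω ∂μ, Tendsto (fun j : ℕ =>
      gridDeviation μ X d v R N (j + 2) ((j + 1) ^ (2 * (d * n) + 2)) ω /
        ((j : ℝ) + 1) ^ (2 * (d * n) + 2)) atTop (𝓝 0) := by
  set k := d * n with hk
  have hsum : Summable fun j : ℕ =>
      ((4 * R + 1 : ℝ) ^ k * N.card) ^ 2 * (2 * C) ^ 2 * (1 / ((j : ℝ) + 1) ^ 2) := by
    refine Summable.mul_left _ ?_
    have := (summable_nat_add_iff 1).2 (Real.summable_one_div_nat_pow.2 one_lt_two)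
    simpa using this
  refine ae_tendsto_zero_of_summable_integral_sq
    (fun j => (measurable_gridDeviation hX hv R N _ _).div_const _) (fun j => ?_) hsum fun j => ?_
  · simp_rw [div_pow]
    exact (integrable_gridDeviation_sq hX hv hC R N _ _).div_const _
  · simp_rw [div_pow]
    have hj : (0 : ℝ) < (j : ℝ) + 1 := by positivity
    rw [integral_div, div_le_iff₀ (by positivity)]
    refine (integral_gridDeviation_sq_le hX hXerg hXmem hv hC R N _ _).trans ?_
    rw [← hk]
    push_cast
    have h1 : (2 * R * ((j : ℝ) + 2) + 1) ^ k ≤ (4 * R + 1 : ℝ) ^ k * ((j : ℝ) + 1) ^ k := by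
      rw [← mul_pow]
      refine pow_le_pow_left₀ (by positivity) ?_ k
      have h2 : (0 : ℝ) ≤ R * j := by positivity
      have h3 : (0 : ℝ) ≤ j := by positivity
      nlinarith
    calc ((2 * R * ((j : ℝ) + 2) + 1) ^ k * N.card) ^ 2 *
          (((j : ℝ) + 1) ^ (2 * k + 2) * (2 * C) ^ 2)
        ≤ ((4 * R + 1 : ℝ) ^ k * ((j : ℝ) + 1) ^ k * N.card) ^ 2 *
          (((j : ℝ) + 1) ^ (2 * k + 2) * (2 * C) ^ 2) := by gcongr
      _ = _ := by
        field_simp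
        ring

/-- Uniformly over the functions with polylogarithmic Lipschitz constant, the average loss is
eventually not much smaller than the average of the conditionally optimal losses. -/
lemma ae_eventually_average_minWindowMean_le (hX : ∀ t, Measurable (X t))
    (hXerg : IsStationaryErgodicProcess μ X) (hXmem : HasMemoryBoundedBy μ X d)
    (hv : ∀ y, Measurable (v y)) {C : ℝ} (hC : ∀ y x, |v y x| ≤ C)
    {𝒳 : Set (EuclideanSpace ℝ (Fin n))} (h𝒳 : IsCompact 𝒳) (hX𝒳 : ∀ t ω, X t ω ∈ 𝒳)
    {𝒴 : Set (EuclideanSpace ℝ (Fin m))} (h𝒴 : IsCompact 𝒴) (hne : 𝒴.Nonempty) {K : ℝ}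
    (hK0 : 0 ≤ K) (hK : ∀ y y' x, |v y x - v y' x| ≤ K * dist y y') {L : ℕ → ℝ≥0} {p : ℝ}
    (hL : (fun T : ℕ => (L T : ℝ)) =O[atTop] fun T : ℕ => Real.log T ^ p) {δ : ℝ} (hδ : 0 < δ) :
    ∀ᵐ ω ∂μ, ∀ᶠ T : ℕ in atTop, ∀ g ∈ lipschitzClass d 𝒳 𝒴 (L T),
      (1 / (T : ℝ)) * ∑ t ∈ Finset.Icc 1 T, minWindowMean μ X d 𝒴 v (window X d t ω) ≤
        averageLoss X d v g T ω + (2 * K + 1) * δ := by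
  obtain ⟨N, hN𝒴, hN⟩ : ∃ N : Finset (EuclideanSpace ℝ (Fin m)), (∀ y ∈ N, y ∈ 𝒴) ∧
      ∀ y ∈ 𝒴, ∃ z ∈ N, dist y z ≤ δ := by
    obtain ⟨N, hN1, hN2, hN3⟩ := h𝒴.finite_cover_balls hδ
    refine ⟨hN2.toFinset, fun y hy => hN1 (by simpa using hy), fun y hy => ?_⟩
    obtain ⟨z, hz, hyz⟩ := Set.mem_iUnion₂.1 (hN3 hy)
    exact ⟨z, by simpa using hz, (Metric.mem_ball.1 hyz).le⟩
  obtain ⟨R, hR⟩ : ∃ R : ℕ, ∀ x ∈ 𝒳, ‖x‖ ≤ R := by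
    obtain ⟨r, hr⟩ := h𝒳.isBounded.exists_norm_le
    obtain ⟨R, hR⟩ := exists_nat_ge r
    exact ⟨R, fun x hx => (hr x hx).trans hR⟩
  set s := 2 * (d * n) + 2 with hs
  have hs0 : s ≠ 0 := by omega
  have hsr : (0 : ℝ) < s := by exact_mod_cast Nat.pos_of_ne_zero hs0
  have hC0 : 0 ≤ C := (abs_nonneg _).trans (hC 0 0)
  filter_upwards [ae_tendsto_gridDeviation_div hX hXerg hXmem hv hC R N] with ω hω
  rw [← hs] at hω
  -- Besides the deviation, the error contains the gap from (j+1)^s to T < (j+2)^s, where each term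
  -- is at most 2C.
  have herr := hω.add ((tendsto_ratio_pow s).const_mul (2 * C))
  rw [mul_zero, add_zero] at herr
  obtain ⟨J, hJ⟩ := eventually_atTop.1 (herr.eventually_le_const hδ)
  filter_upwards [eventually_mul_le_of_isBigO_log hL (one_div_pos.2 hsr) hδ (d * n),
    eventually_ge_atTop ((J + 2) ^ s), eventually_ge_atTop 1] with T hLT hTJ hT1 g hg
  obtain ⟨j, hj1, hj2⟩ := exists_pow_le_lt_pow hs0 hT1
  have hJj : J ≤ j := by
    have := lt_of_pow_lt_pow_left₀ s (by omega) (hTJ.trans_lt hj2)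
    omega
  have hT0 : (0 : ℝ) < T := by exact_mod_cast hT1
  have hj0 : (0 : ℝ) < (j : ℝ) + 1 := by positivity
  -- The grid has mesh 1/(j+2) ≤ T^(-1/s), fine enough for the Lipschitz constant `L T` at the
  -- actual time `T`, although the comparison is made at time (j+1)^s.
  have hroot : (T : ℝ) ^ (1 / (s : ℝ)) ≤ (j : ℝ) + 2 := by
    have h1 : (T : ℝ) ≤ ((j : ℝ) + 2) ^ (s : ℝ) := by
      rw [Real.rpow_natCast]
      exact_mod_cast hj2.le
    calc (T : ℝ) ^ (1 / (s : ℝ)) ≤ (((j : ℝ) + 2) ^ (s : ℝ)) ^ (1 / (s : ℝ)) :=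
          Real.rpow_le_rpow hT0.le h1 (by positivity)
      _ = (j : ℝ) + 2 := by
          rw [← Real.rpow_mul (by positivity), mul_one_div_cancel hsr.ne', Real.rpow_one]
  have hLδ : (L T : ℝ) * (d * n / ((j + 2 : ℕ) : ℝ)) ≤ δ := by
    rw [← mul_div_assoc, div_le_iff₀ (by positivity)]
    push_cast
    calc (L T : ℝ) * (d * n) = d * n * L T := by ring
      _ ≤ δ * (T : ℝ) ^ (1 / (s : ℝ)) := hLT
      _ ≤ δ * (j + 2) := by gcongr
  have hmain := sum_minWindowMean_le (μ := μ) hC hK0 hK (fun t => hX𝒳 t ω) hR hN𝒴 hN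
    (by omega : 0 < j + 2) hLδ hg ((j + 1) ^ s)
  have htail := sum_Icc_le_add_mul (a := fun t => minWindowMean μ X d 𝒴 v (window X d t ω) -
    v (g (window X d t ω)) (X t ω)) (B := 2 * C) (fun t => by
      have h1 := (abs_le.1 (abs_minWindowMean_le (μ := μ) (X := X) hC hne (window X d t ω))).2
      have h2 := (abs_le.1 (hC (g (window X d t ω)) (X t ω))).1
      linarith) hj1
  have hTle : (T : ℝ) ≤ ((j : ℝ) + 2) ^ s := by exact_mod_cast hj2.le
  have hleT : ((j : ℝ) + 1) ^ s ≤ T := by exact_mod_cast hj1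
  have hpos : (0 : ℝ) < ((j : ℝ) + 1) ^ s := by positivity
  have hJj' := mul_le_mul_of_nonneg_right (hJ j hJj) hpos.le
  rw [div_pow, add_mul, div_mul_cancel₀ _ hpos.ne', mul_assoc, sub_mul,
    div_mul_cancel₀ _ hpos.ne', one_mul] at hJj'
  rw [Finset.sum_sub_distrib, Finset.sum_sub_distrib] at htail
  push_cast at htail hmain
  have hfin : ∑ t ∈ Finset.Icc 1 T, minWindowMean μ X d 𝒴 v (window X d t ω) ≤
      ∑ t ∈ Finset.Icc 1 T, v (g (window X d t ω)) (X t ω) + (2 * K + 1) * δ * T := by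
    have h1 : 2 * C * ((T : ℝ) - (j + 1) ^ s) ≤ 2 * C * ((j + 2) ^ s - (j + 1) ^ s) := by gcongr
    have h2 : 2 * K * δ * ((j : ℝ) + 1) ^ s ≤ 2 * K * δ * T := by gcongr
    have h3 : δ * ((j : ℝ) + 1) ^ s ≤ δ * T := by gcongr
    linarith
  rw [averageLoss]
  calc _ ≤ (1 / (T : ℝ)) * (∑ t ∈ Finset.Icc 1 T, v (g (window X d t ω)) (X t ω) +
        (2 * K + 1) * δ * T) := by gcongr
    _ = _ := by field_simp

end LowerBound

/-! ### Convex projection, Lipschitz approximation and extension. -/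

section Analysis

/-- The metric projection onto a complete convex set is nonexpansive. -/
lemma exists_lipschitzWith_one_mapsTo_convex {F : Type*} [NormedAddCommGroup F]
    [InnerProductSpace ℝ F] {s : Set F} (hne : s.Nonempty) (hc : IsComplete s)
    (hconv : Convex ℝ s) :
    ∃ P : F → F, LipschitzWith 1 P ∧ (∀ x, P x ∈ s) ∧ ∀ x ∈ s, P x = x := by
  choose P hPs hP using exists_norm_eq_iInf_of_complete_convex hne hc hconv
  have hinner : ∀ x, ∀ w ∈ s, inner ℝ (x - P x) (w - P x) ≤ 0 := fun x =>
    (norm_eq_iInf_iff_real_inner_le_zero hconv (hPs x)).1 (hP x)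
  refine ⟨P, LipschitzWith.of_dist_le_mul fun x y => ?_, hPs, fun x hx => ?_⟩
  · rw [NNReal.coe_one, one_mul, dist_eq_norm, dist_eq_norm]
    have h1 := hinner x (P y) (hPs y)
    have h2 := hinner y (P x) (hPs x)
    have h3 : ‖P x - P y‖ ^ 2 ≤ inner ℝ (x - y) (P x - P y) := by
      rw [← real_inner_self_eq_norm_sq]
      have e1 : inner ℝ (x - P x) (P y - P x) = -inner ℝ (x - P x) (P x - P y) := by
        rw [← inner_neg_right, neg_sub]
      have e2 : inner ℝ (x - y) (P x - P y) - inner ℝ (P x - P y) (P x - P y) =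
          inner ℝ (x - P x) (P x - P y) - inner ℝ (y - P y) (P x - P y) := by
        rw [← inner_sub_left, ← inner_sub_left]
        congr 1
        abel
      linarith
    have h4 := h3.trans (real_inner_le_norm _ _)
    by_contra! hlt
    have h5 : 0 < ‖P x - P y‖ := (norm_nonneg _).trans_lt hlt
    nlinarith
  · have h := hinner x x hx
    rw [real_inner_self_eq_norm_sq] at h
    have h0 : ‖x - P x‖ = 0 := by nlinarith [norm_nonneg (x - P x)]
    exact (sub_eq_zero.1 (norm_eq_zero.1 h0)).symm

/-- Measurable functions with values in a compact convex set can be approximated in mean by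
Lipschitz functions with values in that set. -/
lemma exists_lipschitzWith_integral_norm_sub_le {E F : Type*} [NormedAddCommGroup E]
    [NormedSpace ℝ E] [FiniteDimensional ℝ E] [MeasurableSpace E] [BorelSpace E]
    [NormedAddCommGroup F] [InnerProductSpace ℝ F] [MeasurableSpace F] [BorelSpace F]
    [SecondCountableTopology F] {ν : Measure E} [IsProbabilityMeasure ν] {s : Set F}
    (hs : IsCompact s) (hconv : Convex ℝ s) {h : E → F} (hh : Measurable h) (hhs : ∀ w, h w ∈ s)
    {δ : ℝ} (hδ : 0 < δ) :
    ∃ (L : ℝ≥0) (g : E → F), LipschitzWith L g ∧ (∀ w, g w ∈ s) ∧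
      ∫ w, ‖g w - h w‖ ∂ν ≤ δ := by
  obtain ⟨r, hr⟩ := hs.isBounded.exists_norm_le
  have hmem : MemLp h 1 ν :=
    memLp_one_iff_integrable.2 (Integrable.of_bound hh.aestronglyMeasurable r
      (ae_of_all _ fun w => hr _ (hhs w)))
  obtain ⟨g₀, hg₀c, hg₀s, hg₀⟩ := hmem.exist_eLpNorm_sub_le ENNReal.one_ne_top le_rfl hδ
  obtain ⟨L, hL⟩ := ContDiff.lipschitzWith_of_hasCompactSupport hg₀c hg₀s (by simp)
  -- The smooth approximant may leave `s`. Projecting back does not increase the error, because the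
  -- projection is nonexpansive and fixes the values of `h`.
  obtain ⟨P, hP1, hPs, hPid⟩ :=
    exists_lipschitzWith_one_mapsTo_convex ⟨h 0, hhs 0⟩ hs.isComplete hconv
  refine ⟨1 * L, P ∘ g₀, hP1.comp hL, fun w => hPs _, ?_⟩
  have hi0 : Integrable (h - g₀) ν := by
    refine (memLp_one_iff_integrable.1 hmem).sub ?_
    obtain ⟨c, hc⟩ := hg₀c.exists_bound_of_continuous hL.continuous
    exact Integrable.of_bound hL.continuous.aestronglyMeasurable c (ae_of_all _ hc)
  calc ∫ w, ‖(P ∘ g₀) w - h w‖ ∂ν ≤ ∫ w, ‖(h - g₀) w‖ ∂ν := by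
        refine integral_mono_of_nonneg (ae_of_all _ fun w => norm_nonneg _) hi0.norm
          (ae_of_all _ fun w => ?_)
        have h1 := hP1.dist_le_mul (g₀ w) (h w)
        rw [hPid _ (hhs w), NNReal.coe_one, one_mul, dist_eq_norm, dist_comm, dist_eq_norm] at h1
        exact h1
    _ ≤ δ := by
        rw [integral_norm_eq_lintegral_enorm hi0.aestronglyMeasurable,
          ← eLpNorm_one_eq_lintegral_enorm]
        exact ENNReal.toReal_le_of_le_ofReal hδ.le hg₀

/-- A Lipschitz function on a compact product extends to a bounded globally Lipschitz one. -/
lemma exists_bounded_lipschitz_extension {E F : Type*} [PseudoMetricSpace E] [PseudoMetricSpace F]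
    {s : Set E} {t : Set F} (hs : IsCompact s) (ht : IsCompact t) {u : E → F → ℝ} {K : ℝ≥0}
    (hu : LipschitzOnWith K (fun p : E × F => u p.1 p.2) (s ×ˢ t)) :
    ∃ (C : ℝ) (v : E → F → ℝ), (∀ y x, |v y x| ≤ C) ∧
      LipschitzWith K (fun p : E × F => v p.1 p.2) ∧ ∀ y ∈ s, ∀ x ∈ t, v y x = u y x := by
  obtain ⟨C, hC⟩ := (hs.prod ht).exists_bound_of_continuousOn hu.continuousOn
  obtain ⟨f, hf, hfu⟩ := hu.extend_real
  -- Clipping bounds the extension without changing it on the product. The absolute value covers an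
  -- empty product, where `C` could be negative.
  refine ⟨|C|, fun y x => max (min (f (y, x)) |C|) (-|C|), fun y x => ?_,
    (hf.min_const |C|).max_const (-|C|), fun y hy x hx => ?_⟩
  · rw [abs_le]
    exact ⟨le_max_right _ _, max_le (min_le_right _ _) (by linarith [abs_nonneg C])⟩
  · have h1 : |u y x| ≤ |C| := (hC (y, x) ⟨hy, hx⟩).trans (le_abs_self C)
    have h2 : f (y, x) = u y x := (hfu ⟨hy, hx⟩).symm
    rw [abs_le] at h1
    beta_reduce
    rw [h2, min_eq_left h1.2, max_eq_left h1.1]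

end Analysis

/-! ### Near-optimal Lipschitz decision rules. -/

section UpperBound

variable {Ω : Type*} [MeasurableSpace Ω] {μ : Measure Ω} [IsProbabilityMeasure μ] {n m d : ℕ}
  {X : ℤ → Ω → EuclideanSpace ℝ (Fin n)}
  {v : EuclideanSpace ℝ (Fin m) → EuclideanSpace ℝ (Fin n) → ℝ}

lemma integrable_of_measurable_bounded {α : Type*} [MeasurableSpace α] {ν : Measure α}
    [IsFiniteMeasure ν] {f : α → ℝ} (hf : Measurable f) {C : ℝ} (hC : ∀ x, |f x| ≤ C) :
    Integrable f ν :=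
  Integrable.of_bound hf.aestronglyMeasurable C (ae_of_all _ hC)

lemma abs_windowMean_sub_le (hv : ∀ y, Measurable (v y)) {C : ℝ} (hC : ∀ y x, |v y x| ≤ C)
    {K : ℝ} (hK : ∀ y y' x, |v y x - v y' x| ≤ K * dist y y') (y y' : EuclideanSpace ℝ (Fin m))
    (w : WindowSpace n d) :
    |windowMean μ X d (v y) w - windowMean μ X d (v y') w| ≤ K * dist y y' := by
  rw [windowMean, windowMean, ← integral_sub (integrable_of_measurable_bounded (hv y) (hC y))
    (integrable_of_measurable_bounded (hv y') (hC y'))]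
  simpa using norm_integral_le_of_norm_le_const
    (μ := condDistrib (X 0) (window X d 0) μ w) (f := fun x => v y x - v y' x)
    (C := K * dist y y') (ae_of_all _ (hK y y'))

/-- Continuity in the decision reduces the infimum to a countable dense set. -/
lemma measurable_minWindowMean (hv : ∀ y, Measurable (v y)) {C : ℝ} (hC : ∀ y x, |v y x| ≤ C)
    {K : ℝ} (hK : ∀ y y' x, |v y x - v y' x| ≤ K * dist y y')
    (𝒴 : Set (EuclideanSpace ℝ (Fin m))) : Measurable (minWindowMean μ X d 𝒴 v) := by
  obtain ⟨D, hDc, hDd⟩ := TopologicalSpace.exists_countable_dense 𝒴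
  have hcont : ∀ w : WindowSpace n d, Continuous fun y : 𝒴 => windowMean μ X d (v y) w := by
    intro w
    refine LipschitzWith.continuous (K := K.toNNReal) (LipschitzWith.of_dist_le_mul fun y y' => ?_)
    rw [Real.dist_eq]
    refine (abs_windowMean_sub_le hv hC hK _ _ w).trans ?_
    exact mul_le_mul_of_nonneg_right (Real.le_coe_toNNReal K) dist_nonneg
  have heq : minWindowMean μ X d 𝒴 v = fun w => ⨅ y : D, windowMean μ X d (v y.1) w := by
    funext w
    exact (hDd.ciInf' (hcont w)).symm
  have : Countable D := hDc.to_subtype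
  rw [heq]
  exact Measurable.iInf fun y => measurable_windowMean (hv y.1)

lemma measurable_windowMean_comp (hv : Measurable fun q : EuclideanSpace ℝ (Fin m) ×
      EuclideanSpace ℝ (Fin n) => v q.1 q.2) {h : WindowSpace n d → EuclideanSpace ℝ (Fin m)}
    (hh : Measurable h) : Measurable fun w => windowMean μ X d (v (h w)) w :=
  (StronglyMeasurable.integral_condDistrib (X := window X d 0) (Y := X 0) (μ := μ)
    (f := fun q : WindowSpace n d × EuclideanSpace ℝ (Fin n) => v (h q.1) q.2)
    (hv.comp ((hh.comp measurable_fst).prodMk measurable_snd)).stronglyMeasurable).measurable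

/-- For finitely many decisions a minimizer can be chosen measurably by successive comparison, so no
measurable selection theorem is needed. -/
lemma exists_measurable_argmin (hv : Measurable fun q : EuclideanSpace ℝ (Fin m) ×
      EuclideanSpace ℝ (Fin n) => v q.1 q.2) (N : Finset (EuclideanSpace ℝ (Fin m)))
    (hN : N.Nonempty) :
    ∃ h : WindowSpace n d → EuclideanSpace ℝ (Fin m), Measurable h ∧ (∀ w, h w ∈ N) ∧
      ∀ w, ∀ y ∈ N, windowMean μ X d (v (h w)) w ≤ windowMean μ X d (v y) w := by
  induction hN using Finset.Nonempty.cons_induction with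
  | singleton a => exact ⟨fun _ => a, measurable_const, by simp, by simp⟩
  | cons a s ha hs ih =>
    obtain ⟨h, hm, hmem, hmin⟩ := ih
    have hva : Measurable (v a) := hv.comp measurable_prodMk_left
    have hF := measurable_windowMean_comp (μ := μ) (X := X) hv hm
    classical
    refine ⟨fun w => if windowMean μ X d (v a) w ≤ windowMean μ X d (v (h w)) w then a else h w,
      Measurable.ite (measurableSet_le (measurable_windowMean hva) hF) measurable_const hm,
      fun w => ?_, fun w y hy => ?_⟩
    · dsimp only
      split_ifs
      · simp
      · simp [hmem w]
    · dsimp only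
      rw [Finset.mem_cons] at hy
      split_ifs with hle
      · rcases hy with rfl | hy
        · exact le_rfl
        · exact hle.trans (hmin w y hy)
      · rcases hy with rfl | hy
        · exact (not_le.1 hle).le
        · exact hmin w y hy

lemma integral_comp_window_eq (hX : ∀ t, Measurable (X t))
    (hv : Measurable fun q : EuclideanSpace ℝ (Fin m) × EuclideanSpace ℝ (Fin n) => v q.1 q.2)
    {C : ℝ} (hC : ∀ y x, |v y x| ≤ C) {h : WindowSpace n d → EuclideanSpace ℝ (Fin m)}
    (hh : Measurable h) :
    ∫ ω, v (h (window X d 0 ω)) (X 0 ω) ∂μ =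
      ∫ ω, windowMean μ X d (v (h (window X d 0 ω))) (window X d 0 ω) ∂μ := by
  have hw := measurable_window (d := d) hX 0
  have hf : Measurable fun q : WindowSpace n d × EuclideanSpace ℝ (Fin n) => v (h q.1) q.2 :=
    hv.comp ((hh.comp measurable_fst).prodMk measurable_snd)
  have hce := condExp_prod_ae_eq_integral_condDistrib (μ := μ) hw (hX 0).aemeasurable
    hf.stronglyMeasurable
    (integrable_of_measurable_bounded (hf.comp (hw.prodMk (hX 0))) fun ω => hC _ _)
  rw [← integral_condExp hw.comap_le]
  exact integral_congr_ae hce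

/-- There are Lipschitz decision functions whose expected loss is close to the expected
conditionally optimal loss. -/
lemma exists_lipschitzWith_integral_le (hX : ∀ t, Measurable (X t))
    (hv : Measurable fun q : EuclideanSpace ℝ (Fin m) × EuclideanSpace ℝ (Fin n) => v q.1 q.2)
    {C : ℝ} (hC : ∀ y x, |v y x| ≤ C) {K : ℝ} (hK0 : 0 ≤ K)
    (hK : ∀ y y' x, |v y x - v y' x| ≤ K * dist y y')
    {𝒴 : Set (EuclideanSpace ℝ (Fin m))} (h𝒴 : IsCompact 𝒴) (hconv : Convex ℝ 𝒴)
    (hne : 𝒴.Nonempty) {δ : ℝ} (hδ : 0 < δ) :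
    ∃ (L : ℝ≥0) (g : WindowSpace n d → EuclideanSpace ℝ (Fin m)), LipschitzWith L g ∧
      (∀ w, g w ∈ 𝒴) ∧ ∫ ω, v (g (window X d 0 ω)) (X 0 ω) ∂μ ≤
        ∫ ω, minWindowMean μ X d 𝒴 v (window X d 0 ω) ∂μ + 2 * K * δ := by
  have hvy : ∀ y, Measurable (v y) := fun y => hv.comp measurable_prodMk_left
  obtain ⟨N, hN𝒴, hNfin, hNcov⟩ := h𝒴.finite_cover_balls hδ
  have hNne : hNfin.toFinset.Nonempty := by
    obtain ⟨y, hy⟩ := hne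
    obtain ⟨z, hz, -⟩ := Set.mem_iUnion₂.1 (hNcov hy)
    exact ⟨z, by simpa using hz⟩
  obtain ⟨h, hh, hhN, hmin⟩ := exists_measurable_argmin (μ := μ) (X := X) (d := d) hv _ hNne
  have hh𝒴 : ∀ w, h w ∈ 𝒴 := fun w => hN𝒴 (by simpa using hhN w)
  have hw := measurable_window (d := d) hX 0
  have : IsProbabilityMeasure (μ.map (window X d 0)) :=
    Measure.isProbabilityMeasure_map hw.aemeasurable
  obtain ⟨L, g, hgL, hg𝒴, hgh⟩ := exists_lipschitzWith_integral_norm_sub_le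
    (ν := μ.map (window X d 0)) h𝒴 hconv hh hh𝒴 hδ
  have hgm : Measurable g := hgL.continuous.measurable
  rw [integral_map (f := fun w => ‖g w - h w‖) hw.aemeasurable
    (hgm.sub hh).norm.aestronglyMeasurable] at hgh
  refine ⟨L, g, hgL, hg𝒴, ?_⟩
  have : Nonempty 𝒴 := hne.to_subtype
  -- Restricting decisions to the net costs `K * δ`; the L¹ smoothing in `hstep1` costs another.
  have hpt : ∀ w, windowMean μ X d (v (h w)) w ≤ minWindowMean μ X d 𝒴 v w + K * δ := by
    intro w
    rw [← sub_le_iff_le_add]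
    refine le_ciInf fun y => ?_
    obtain ⟨z, hz, hyz⟩ := Set.mem_iUnion₂.1 (hNcov y.2)
    have h1 := hmin w z (by simpa using hz)
    have h2 := abs_windowMean_sub_le (μ := μ) (X := X) hvy hC hK z y w
    have h3 : K * dist z y ≤ K * δ := by
      gcongr
      rw [dist_comm]
      exact (Metric.mem_ball.1 hyz).le
    linarith [(abs_le.1 (h2.trans h3)).2]
  have hloss : ∀ f : WindowSpace n d → EuclideanSpace ℝ (Fin m), Measurable f →
      Integrable (fun ω => v (f (window X d 0 ω)) (X 0 ω)) μ := fun f hf =>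
    integrable_of_measurable_bounded (hv.comp ((hf.comp hw).prodMk (hX 0))) fun ω => hC _ _
  have hstep1 : ∫ ω, v (g (window X d 0 ω)) (X 0 ω) ∂μ ≤
      ∫ ω, v (h (window X d 0 ω)) (X 0 ω) ∂μ + K * δ := by
    obtain ⟨r, hr⟩ := h𝒴.isBounded.exists_norm_le
    have hi : Integrable (fun ω => ‖g (window X d 0 ω) - h (window X d 0 ω)‖) μ :=
      integrable_of_measurable_bounded (C := r + r) ((hgm.comp hw).sub (hh.comp hw)).norm
        fun ω => by
          rw [abs_norm]
          exact (norm_sub_le _ _).trans (add_le_add (hr _ (hg𝒴 _)) (hr _ (hh𝒴 _)))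
    calc _ ≤ ∫ ω, (v (h (window X d 0 ω)) (X 0 ω) +
            K * ‖g (window X d 0 ω) - h (window X d 0 ω)‖) ∂μ := by
          refine integral_mono (hloss g hgm) ((hloss h hh).add (hi.const_mul K)) fun ω => ?_
          have h1 := hK (g (window X d 0 ω)) (h (window X d 0 ω)) (X 0 ω)
          rw [dist_eq_norm] at h1
          dsimp only
          linarith [(abs_le.1 h1).2]
      _ = ∫ ω, v (h (window X d 0 ω)) (X 0 ω) ∂μ +
            K * ∫ ω, ‖g (window X d 0 ω) - h (window X d 0 ω)‖ ∂μ := by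
          rw [integral_add (hloss h hh) (hi.const_mul K), integral_const_mul]
      _ ≤ _ := by gcongr
  have hφi : Integrable (fun ω => minWindowMean μ X d 𝒴 v (window X d 0 ω)) μ :=
    integrable_of_measurable_bounded ((measurable_minWindowMean hvy hC hK 𝒴).comp hw)
      fun ω => abs_minWindowMean_le hC hne _
  have hstep2 : ∫ ω, v (h (window X d 0 ω)) (X 0 ω) ∂μ ≤
      ∫ ω, minWindowMean μ X d 𝒴 v (window X d 0 ω) ∂μ + K * δ := by
    rw [integral_comp_window_eq hX hv hC hh]
    have hmi : Integrable
        (fun ω => windowMean μ X d (v (h (window X d 0 ω))) (window X d 0 ω)) μ := by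
      exact integrable_of_measurable_bounded (C := C) (Measurable.comp
        (g := fun w => windowMean μ X d (v (h w)) w) (measurable_windowMean_comp hv hh) hw)
        fun ω => abs_windowMean_le (hC _) _
    calc _ ≤ ∫ ω, (minWindowMean μ X d 𝒴 v (window X d 0 ω) + K * δ) ∂μ :=
          integral_mono hmi (hφi.add (integrable_const _)) fun ω => hpt _
      _ = _ := by rw [integral_add hφi (integrable_const _)]; simp
  linarith

end UpperBound

/-! ### Identification of the optimal loss and conclusion. -/

section Main

lemma averageLoss_congr {Ω : Type*} {n m d : ℕ} {X : ℤ → Ω → EuclideanSpace ℝ (Fin n)}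
    {u v : EuclideanSpace ℝ (Fin m) → EuclideanSpace ℝ (Fin n) → ℝ}
    {𝒳 : Set (EuclideanSpace ℝ (Fin n))}
    {𝒴 : Set (EuclideanSpace ℝ (Fin m))} (huv : ∀ y ∈ 𝒴, ∀ x ∈ 𝒳, v y x = u y x)
    (hX𝒳 : ∀ t ω, X t ω ∈ 𝒳) {g : WindowSpace n d → EuclideanSpace ℝ (Fin m)}
    (hg : Set.MapsTo g (windowSet d 𝒳) 𝒴) (T : ℕ) (ω : Ω) :
    averageLoss X d v g T ω = averageLoss X d u g T ω := by
  unfold averageLoss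
  congr 1
  refine Finset.sum_congr rfl fun t _ => huv _ (hg ?_) _ (hX𝒳 _ _)
  exact window_mem_windowSet (fun t => hX𝒳 t ω) t

variable {Ω : Type*} [MeasurableSpace Ω] {μ : Measure Ω} [IsProbabilityMeasure μ] {n m d : ℕ}
  {X : ℤ → Ω → EuclideanSpace ℝ (Fin n)}
  {u v : EuclideanSpace ℝ (Fin m) → EuclideanSpace ℝ (Fin n) → ℝ}

/-- Time averages of a bounded function of the current window and observation. -/
lemma ae_tendsto_average_window (hX : ∀ t, Measurable (X t))
    (hXerg : IsStationaryErgodicProcess μ X)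
    {ψ : WindowSpace n d × EuclideanSpace ℝ (Fin n) → ℝ} (hψ : Measurable ψ) {C : ℝ}
    (hC : ∀ q, |ψ q| ≤ C) :
    ∀ᵐ ω ∂μ, Tendsto (fun T : ℕ => (1 / (T : ℝ)) * ∑ t ∈ Finset.Icc 1 T,
      ψ (window X d t ω, X t ω)) atTop (𝓝 (∫ ω, ψ (window X d 0 ω, X 0 ω) ∂μ)) := by
  have hcoord : ∀ t : ℤ, Measurable fun x : ℤ → EuclideanSpace ℝ (Fin n) => x t :=
    fun t => measurable_pi_apply t
  have h := hXerg.ae_tendsto_average hX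
    (G := fun x => ψ (window (fun t x => x t) d 0 x, x 0))
    (hψ.comp ((measurable_window hcoord 0).prodMk (hcoord 0))) (C := C) fun x => hC _
  have hwin : ∀ (t : ℕ) (ω : Ω), window (fun t (x : ℤ → EuclideanSpace ℝ (Fin n)) => x t) d 0
      (fun s => X (s + t) ω) = window X d t ω := by
    intro t ω
    simp only [window]
    congr 1
    funext i
    congr 1
    ring
  simp only [hwin, zero_add] at h
  exact h

/-- The kernel masses of the complement integrate to the probability that `X 0` leaves 𝒳, which is
zero. This allows `u` and `v` to be exchanged under the conditional law. -/
lemma ae_condDistrib_compl_eq_zero {β : Type*} [MeasurableSpace β] {Y : Ω → β}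
    (hY : Measurable Y) (hX : Measurable (X 0)) {𝒳 : Set (EuclideanSpace ℝ (Fin n))}
    (h𝒳 : MeasurableSet 𝒳) (hX𝒳 : ∀ ω, X 0 ω ∈ 𝒳) :
    ∀ᵐ ω ∂μ, condDistrib (X 0) Y μ (Y ω) 𝒳ᶜ = 0 := by
  have h := setLIntegral_preimage_condDistrib (μ := μ) hY hX.aemeasurable h𝒳.compl
    (MeasurableSet.univ (α := β))
  have hempty : X 0 ⁻¹' 𝒳ᶜ = ∅ := by
    ext ω
    simp [hX𝒳 ω]
  rw [Set.preimage_univ, Measure.restrict_univ, hempty, Set.inter_empty, measure_empty] at h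
  exact (lintegral_eq_zero_iff ((Kernel.measurable_coe _ h𝒳.compl).comp hY)).1 h

/-- Under bounded memory the optimal loss is the expected conditionally optimal loss given the
last `d` observations. -/
lemma optimalLoss_eq_integral_minWindowMean (hX : ∀ t, Measurable (X t))
    (hXmem : HasMemoryBoundedBy μ X d) {𝒳 : Set (EuclideanSpace ℝ (Fin n))}
    (h𝒳 : MeasurableSet 𝒳) (hX𝒳 : ∀ t ω, X t ω ∈ 𝒳) {𝒴 : Set (EuclideanSpace ℝ (Fin m))}
    (huv : ∀ y ∈ 𝒴, ∀ x ∈ 𝒳, v y x = u y x) :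
    optimalLoss μ X 𝒴 u = ∫ ω, minWindowMean μ X d 𝒴 v (window X d 0 ω) ∂μ := by
  refine integral_congr_ae ?_
  have hpast : Measurable (infinitePast X) := measurable_pi_lambda _ fun _ => hX _
  filter_upwards [hXmem, ae_condDistrib_compl_eq_zero (μ := μ) hpast (hX 0) h𝒳 (hX𝒳 0)]
    with ω h1 h2
  refine iInf_congr fun y => ?_
  rw [windowMean, ← h1]
  refine integral_congr_ae ?_
  have h3 : ∀ᵐ x ∂(condDistrib (X 0) (infinitePast X) μ (infinitePast X ω)), x ∈ 𝒳 := h2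
  filter_upwards [h3] with x hx
  exact (huv y y.2 x hx).symm

end Main

theorem mainTheorem1 {Ω : Type*} [MeasurableSpace Ω] (μ : Measure Ω) [IsProbabilityMeasure μ]
    (n m d : ℕ)
    -- the compact observation space, the compact convex decision space, and the loss
    (𝒳 : Set (EuclideanSpace ℝ (Fin n))) (h𝒳 : IsCompact 𝒳)
    (𝒴 : Set (EuclideanSpace ℝ (Fin m))) (h𝒴 : IsCompact 𝒴) (h𝒴conv : Convex ℝ 𝒴)
    (u : EuclideanSpace ℝ (Fin m) → EuclideanSpace ℝ (Fin n) → ℝ)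
    (K : ℝ≥0)
    (hu : LipschitzOnWith K
      (fun p : EuclideanSpace ℝ (Fin m) × EuclideanSpace ℝ (Fin n) => u p.1 p.2) (𝒴 ×ˢ 𝒳))
    (huconv : ∀ x ∈ 𝒳, ConvexOn ℝ 𝒴 fun y => u y x)
    -- the process
    (X : ℤ → Ω → EuclideanSpace ℝ (Fin n))
    (hXmeas : ∀ t, Measurable (X t)) (hX𝒳 : ∀ t ω, X t ω ∈ 𝒳)
    (hXerg : IsStationaryErgodicProcess μ X)
    (hXmix : IsExponentiallyBetaMixing μ X)
    (hXmem : HasMemoryBoundedBy μ X d)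
    -- the growing Lipschitz constants
    (L : ℕ → ℝ≥0) (hLtop : Tendsto L atTop atTop)
    (p : ℝ) (hLlog : (fun T : ℕ => (L T : ℝ)) =O[atTop] fun T : ℕ => Real.log T ^ p)
    -- the predictors: data-dependent exact minimizers of the empirical loss in the class
    (f : ℕ → Ω → WindowSpace n d → EuclideanSpace ℝ (Fin m))
    (hfLip : ∀ᵐ ω ∂μ, ∀ T : ℕ, 1 ≤ T → f T ω ∈ lipschitzClass d 𝒳 𝒴 (L T))
    (hfmin : ∀ᵐ ω ∂μ, ∀ T : ℕ, 1 ≤ T → ∀ g ∈ lipschitzClass d 𝒳 𝒴 (L T),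
      averageLoss X d u (f T ω) T ω ≤ averageLoss X d u g T ω) :
    ∀ᵐ ω ∂μ, Tendsto (fun T : ℕ => averageLoss X d u (f T ω) T ω) atTop
      (𝓝 (optimalLoss μ X 𝒴 u)) := by
  -- The predictor at `T = 1` supplies a point of 𝒴.
  have hne : 𝒴.Nonempty := by
    obtain ⟨ω, hω⟩ := hfLip.exists
    exact ⟨_, (hω 1 le_rfl).2 (window_mem_windowSet (fun t => hX𝒳 t ω) 0)⟩
  obtain ⟨C, v, hC, hvL, huv⟩ := exists_bounded_lipschitz_extension h𝒴 h𝒳 hu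
  have hv := hvL.continuous.measurable
  have hvy : ∀ y, Measurable (v y) := fun y => hv.comp measurable_prodMk_left
  have hK : ∀ y y' x, |v y x - v y' x| ≤ K * dist y y' := fun y y' x => by
    have h := hvL.dist_le_mul (y, x) (y', x)
    rwa [Prod.dist_eq, dist_self, max_eq_left dist_nonneg, Real.dist_eq] at h
  have hK0 : (0 : ℝ) ≤ K := K.2
  have hδ : ∀ k : ℕ, (0 : ℝ) < 1 / ((k : ℝ) + 1) := fun k => Nat.one_div_pos_of_nat
  rw [optimalLoss_eq_integral_minWindowMean hXmeas hXmem h𝒳.measurableSet hX𝒳 huv]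
  set ℓ := ∫ ω, minWindowMean μ X d 𝒴 v (window X d 0 ω) ∂μ with hℓ
  have hφ := ae_tendsto_average_window (d := d) hXmeas hXerg
    (ψ := fun q => minWindowMean μ X d 𝒴 v q.1)
    ((measurable_minWindowMean hvy hC hK 𝒴).comp measurable_fst)
    fun q => abs_minWindowMean_le hC hne q.1
  have hlower : ∀ᵐ ω ∂μ, ∀ k : ℕ, _ := ae_all_iff.2 fun k =>
    ae_eventually_average_minWindowMean_le hXmeas hXerg hXmem hvy hC h𝒳 hX𝒳 h𝒴 hne hK0 hK
      hLlog (hδ k)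
  choose M g hgL hg𝒴 hgle using fun k : ℕ =>
    exists_lipschitzWith_integral_le (μ := μ) (d := d) hXmeas hv hC hK0 hK h𝒴 h𝒴conv hne (hδ k)
  have hupper : ∀ᵐ ω ∂μ, ∀ k : ℕ, _ := ae_all_iff.2 fun k =>
    ae_tendsto_average_window (d := d) hXmeas hXerg (ψ := fun q => v (g k q.1) q.2)
      (hv.comp (((hgL k).continuous.measurable.comp measurable_fst).prodMk measurable_snd))
      fun q => hC _ _
  filter_upwards [hfLip, hfmin, hφ, hlower, hupper] with ω hLip hmin hφ hlo hup
  rw [Metric.tendsto_nhds]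
  intro ε hε
  -- With δ = 1/(k+1), the lower bound loses (2K+1)δ and the upper one 2Kδ; this choice makes
  -- (2K+2)δ < ε/2.
  obtain ⟨k, hk⟩ := exists_nat_one_div_lt (show (0 : ℝ) < ε / (2 * (2 * K + 2)) by positivity)
  rw [lt_div_iff₀ (by positivity)] at hk
  have hε' : (2 * (K : ℝ) + 1) * (1 / ((k : ℝ) + 1)) < ε / 2 := by linarith [hδ k]
  filter_upwards [hlo k, hφ.eventually_const_lt (show ℓ - ε / 2 < _ by linarith),
    (hup k).eventually_lt_const (show _ < ℓ + ε by linarith [hgle k, hδ k]),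
    hLtop.eventually_ge_atTop (M k), eventually_ge_atTop 1] with T h1 h2 h3 h4 h5
  have hgmem : g k ∈ lipschitzClass d 𝒳 𝒴 (L T) :=
    ⟨((hgL k).weaken h4).lipschitzOnWith, fun w _ => hg𝒴 k w⟩
  -- The lower bound holds for all class members on one event, so it applies to the data-dependent
  -- `f T ω`.
  have h6 := h1 (f T ω) (hLip T h5)
  have h7 := hmin T h5 (g k) hgmem
  rw [averageLoss_congr huv hX𝒳 (hLip T h5).2] at h6
  rw [← averageLoss_congr huv hX𝒳 hgmem.2] at h7
  have h8 : averageLoss X d v (g k) T ω < ℓ + ε := h3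
  rw [Real.dist_eq, abs_lt]
  constructor <;> linarith
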